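/- For a matrix $M\in\mathbb{R}^{n\times d}$ with rows $m_i$ and $M^\top M$ invertible, let $\sigma(M)_i=m_i^\top(M^\top M)^{-1}m_i$ be its leverage scores. For $A\in\mathbb{R}^{n\times d}$ and $p\ge 2$, a vector $w\in\mathbb{R}^n_{\ge 0}$ with $W=\mathrm{diag}(w)$ is a vector of \emph{$\ell_p$ Lewis weight overestimates} of $A$ if $A^\top W^{1-2/p}A$ is invertible, $d\le\|w\|_1\le 2d$, and $w_i\ge\sigma(W^{1/2-1/p}A)_i$ for all $i\in[n]$. The randomized algorithm $\mathrm{ApproxLev}_c(SA,\varepsilon)$, for a nonnegative diagonal matrix $S=\mathrm{diag}(s)$ and $c>0$, draws $k=\lceil c\,\varepsilon^{-2}\log n\rceil$ independent uniform sign vectors $q^{(1)},\dots,q^{(k)}\in\{\pm1\}^n$, computes $z^{(j)}=SA(A^\top S^2A)^{-1}A^\top S q^{(j)}$, with one call of a linear system solver for $A^\top S^2A$ for each $j$, and returns the vector with entries $\frac1k\sum_{j=1}^k (z^{(j)}_i)^2$. The algorithm $\mathrm{ApproxLargeWeights}_c(A,p)$ sets $T=\lceil 10\log n\rceil$ and $w^{(0)}_i=d/n$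 for all $i$, computes $w^{(k+1)}=\mathrm{ApproxLev}_c((W^{(k)})^{1/2-1/p}A,\,1/10)$ for $k=0,\dots,T-1$ with fresh randomness, and returns $w=\frac{3}{2T}\sum_{k=1}^T w^{(k)}$. The solver is exact, and is called for matrices $A^\top DA$ with $D$ a positive diagonal matrix (entries of $D$ at zero rows of $A$ are irrelevant, as they do not affect $A^\top DA$). \textbf{Lemma (computing $\ell_p$ Lewis weight overestimates).} For every constant $C>0$ there are constants $c,K>0$ such that for all $n\ge 1$, all $d$, every $A\in\mathbb{R}^{n\times d}$ of rank $d$ and every real $p\ge 2$: (1) $\mathrm{ApproxLargeWeights}_c(A,p)$ always makes at most $K(1+\log n)^2$ calls of the solver, and performs at most $K(1+\log n)^2(\mathrm{nnz}(A)+n)$ further elementary steps (real additions, subtractions, multiplications, divisions, powers, and random signs), where $\mathrm{nnz}(A)$ is the number of nonzero entries of $A$; (2) with probability at least $1-n^{-C}$, all calls of the solver are for matrices $A^\top DA$ with $D$ positive as above, and the returned vector $w$ is a vector of $\ell_p$ Lewis weight overestimates of $A$. -/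

import Mathlib

open scoped Matrix

noncomputable section

namespace Lewis

/-- The leverage score `σ(M)_i = m_iᵀ (Mᵀ M)⁻¹ m_i`, where `m_i` is the `i`-th row of `M`. -/
def leverageScore {n d : ℕ} (M : Matrix (Fin n) (Fin d) ℝ) (i : Fin n) : ℝ :=
  M i ⬝ᵥ ((Mᵀ * M)⁻¹ *ᵥ M i)

/-- The reweighted matrix `W^{1/2 - 1/p} A`, where `W = diag(w)`. -/
def reweight {n d : ℕ} (w : Fin n → ℝ) (p : ℝ) (A : Matrix (Fin n) (Fin d) ℝ) :
    Matrix (Fin n) (Fin d) ℝ :=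
  Matrix.diagonal (fun i => w i ^ (1 / 2 - 1 / p)) * A

/-- `w` is a vector of `ℓ_p` Lewis weight overestimates of `A`. The field `nonsingular` says that
the inverse in the leverage scores of `W^{1/2 - 1/p} A` is a genuine one. -/
structure IsLewisOverestimate {n d : ℕ} (A : Matrix (Fin n) (Fin d) ℝ) (p : ℝ)
    (w : Fin n → ℝ) : Prop where
  nonneg : ∀ i, 0 ≤ w i
  l1_lower : (d : ℝ) ≤ ∑ i, |w i|
  l1_upper : ∑ i, |w i| ≤ 2 * (d : ℝ)
  nonsingular : IsUnit ((reweight w p A)ᵀ * reweight w p A)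
  dominates : ∀ i, leverageScore (reweight w p A) i ≤ w i

/-- The number of nonzero entries of `A`. -/
def nnz {n d : ℕ} (A : Matrix (Fin n) (Fin d) ℝ) : ℕ :=
  Set.ncard {e : Fin n × Fin d | A e.1 e.2 ≠ 0}

/-! ### Randomized programs on a real-number machine with a linear system solver -/

/-- The elementary operations on real numbers; each has unit cost. -/
inductive Op where
  | add
  | sub
  | mul
  | div
  | pow

def Op.eval : Op → ℝ → ℝ → ℝ
  | .add, x, y => x + y
  | .sub, x, y => x - y
  | .mul, x, y => x * y
  | .div, x, y => x / y
  | .pow, x, y => x ^ y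

/-- Programs (for an `n × d` matrix `A`) that return a value in `α`. They may
* perform an elementary operation on two real numbers,
* draw a vector of `n` independent uniform random signs,
* call a solver for a linear system `(Aᵀ diag(D) A) x = b`. -/
inductive Prog (n d : ℕ) (α : Type) : Type where
  | ret (a : α) : Prog n d α
  | arith (o : Op) (x y : ℝ) (k : ℝ → Prog n d α) : Prog n d α
  | signs (k : (Fin n → ℝ) → Prog n d α) : Prog n d α
  | solve (D : Fin n → ℝ) (b : Fin d → ℝ) (k : (Fin d → ℝ) → Prog n d α) : Prog n d α

namespace Prog

variable {n d : ℕ}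

/-- Sequential composition. -/
def bind {α β : Type} : Prog n d α → (α → Prog n d β) → Prog n d β
  | .ret a, f => f a
  | .arith o x y k, f => .arith o x y fun z => (k z).bind f
  | .signs k, f => .signs fun q => (k q).bind f
  | .solve D b k, f => .solve D b fun x => (k x).bind f

instance : Monad (Prog n d) where
  pure a := .ret a
  bind P f := P.bind f

/-- A single elementary operation. -/
def op (o : Op) (x y : ℝ) : Prog n d ℝ := .arith o x y fun z => .ret z

/-- A single draw of `n` random signs. -/
def drawSigns : Prog n d (Fin n → ℝ) := .signs fun q => .ret q

/-- A single call of the solver. -/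
def callSolver (D : Fin n → ℝ) (b : Fin d → ℝ) : Prog n d (Fin d → ℝ) :=
  .solve D b fun x => .ret x

/-- Run `f 0, …, f (m - 1)` one after the other and collect the results in a vector. -/
def tabulate {α : Type} : (m : ℕ) → (Fin m → Prog n d α) → Prog n d (Fin m → α)
  | 0, _ => pure Fin.elim0
  | m + 1, f => do
      let a ← f 0
      let v ← tabulate m fun i => f i.succ
      pure (Fin.cons a v)

/-- Run `f` on the elements of a list and add up the results. -/
def sumOver {ι : Type} : List ι → (ι → Prog n d ℝ) → Prog n d ℝ
  | [], _ => pure 0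
  | a :: l, f => do
      let x ← f a
      let s ← sumOver l f
      op .add x s

end Prog

/-- The outcome of a run: the returned value, the number of solver calls, the number of all other
elementary steps, and whether each solver call was admissible. -/
structure Outcome (α : Type) where
  val : α
  solves : ℕ
  ops : ℕ
  legal : Prop

/-- The law of the outcome of a program on the matrix `A`. The solver is exact. A call with the
diagonal matrix `diag(D)` is admissible if `D` is positive at each nonzero row of `A`, that is,
if `Aᵀ diag(D) A = Aᵀ diag(D') A` for a positive `D'` (entries at zero rows have no effect).
A draw of `n` signs counts as `n` elementary steps. -/
def Prog.run {n d : ℕ} {α : Type} (A : Matrix (Fin n) (Fin d) ℝ) :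
    Prog n d α → PMF (Outcome α)
  | .ret a => PMF.pure ⟨a, 0, 0, True⟩
  | .arith o x y k =>
      (Prog.run A (k (o.eval x y))).map fun r => { r with ops := r.ops + 1 }
  | .signs k =>
      (PMF.uniformOfFintype (Fin n → Bool)).bind fun q =>
        (Prog.run A (k fun i => if q i then 1 else -1)).map fun r => { r with ops := r.ops + n }
  | .solve D b k =>
      (Prog.run A (k ((Aᵀ * Matrix.diagonal D * A)⁻¹ *ᵥ b))).map fun r =>
        { r with
          solves := r.solves + 1
          legal := (∀ i, A i ≠ 0 → 0 < D i) ∧ r.legal }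

/-! ### The algorithm. The matrix `A` is given in sparse form. -/

section Algorithm

variable {n d : ℕ} (A : Matrix (Fin n) (Fin d) ℝ)

open Classical in
/-- The product `A x`, computed from the nonzero entries of `A`. -/
def mulA (x : Fin d → ℝ) : Prog n d (Fin n → ℝ) :=
  Prog.tabulate n fun i =>
    Prog.sumOver ((List.finRange d).filter fun j => A i j ≠ 0) fun j => Prog.op .mul (A i j) (x j)

open Classical in
/-- The product `Aᵀ u`, computed from the nonzero entries of `A`. -/
def mulAT (u : Fin n → ℝ) : Prog n d (Fin d → ℝ) :=
  Prog.tabulate d fun j =>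
    Prog.sumOver ((List.finRange n).filter fun i => A i j ≠ 0) fun i => Prog.op .mul (A i j) (u i)

/-- With `S = diag(s)`, `D = s²` and `M = S A`: draw `k` sign vectors `q`, compute
`z = M (Mᵀ M)⁻¹ Mᵀ q` for each of them by one call of the solver, and return the sum of the
entrywise squares of the vectors `z`. -/
def sketchSum (s D : Fin n → ℝ) : ℕ → Prog n d (Fin n → ℝ)
  | 0 => pure fun _ => 0
  | k + 1 => do
      let acc ← sketchSum s D k
      let q ← Prog.drawSigns
      let u ← Prog.tabulate n fun i => Prog.op .mul (s i) (q i)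
      let b ← mulAT A u
      let x ← Prog.callSolver D b
      let y ← mulA A x
      Prog.tabulate n fun i => do
        let z ← Prog.op .mul (s i) (y i)
        let z2 ← Prog.op .mul z z
        Prog.op .add (acc i) z2

/-- The number `⌈c ε⁻² log n⌉` of random sign vectors in a leverage score estimate. -/
def sketchSize (n : ℕ) (c ε : ℝ) : ℕ := ⌈c / ε ^ 2 * Real.log n⌉₊

/-- `ApproxLev(diag(s) A, ε)`: the sketched estimate of the leverage scores of `diag(s) A`. -/
def approxLev (c ε : ℝ) (s : Fin n → ℝ) : Prog n d (Fin n → ℝ) := do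
  let D ← Prog.tabulate n fun i => Prog.op .mul (s i) (s i)
  let acc ← sketchSum A s D (sketchSize n c ε)
  Prog.tabulate n fun i => Prog.op .div (acc i) (sketchSize n c ε)

/-- `k` steps of the approximate fixed-point iteration
`w⁽ʲ⁺¹⁾ = ApproxLev((W⁽ʲ⁾)^e A, 1/10)` from `w⁽⁰⁾`; returns `w⁽ᵏ⁾` and `w⁽¹⁾ + ⋯ + w⁽ᵏ⁾`. -/
def lewisIterate (c e : ℝ) (w₀ : Fin n → ℝ) : ℕ → Prog n d ((Fin n → ℝ) × (Fin n → ℝ))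
  | 0 => pure (w₀, fun _ => 0)
  | k + 1 => do
      let (w, total) ← lewisIterate c e w₀ k
      let s ← Prog.tabulate n fun i => Prog.op .pow (w i) e
      let w' ← approxLev A c (1 / 10) s
      let total' ← Prog.tabulate n fun i => Prog.op .add (total i) (w' i)
      pure (w', total')

/-- The number `T = ⌈10 log n⌉` of iterations. -/
def numIter (n : ℕ) : ℕ := ⌈10 * Real.log n⌉₊

/-- `ApproxLargeWeights(A, p)`: start from `w⁽⁰⁾ = (d/n, …, d/n)`, iterate
`w⁽ᵏ⁺¹⁾ = ApproxLev((W⁽ᵏ⁾)^{1/2 - 1/p} A, 1/10)` for `k < T`, return `(3 / (2T)) ∑_{k=1}^T w⁽ᵏ⁾`. -/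
def approxLargeWeights (c p : ℝ) : Prog n d (Fin n → ℝ) := do
  let pinv ← Prog.op .div 1 p
  let e ← Prog.op .sub (1 / 2) pinv
  let a ← Prog.op .div (d : ℝ) (n : ℝ)
  let (_, total) ← lewisIterate A c e (fun _ => a) (numIter n)
  let t2 ← Prog.op .mul 2 (numIter n : ℝ)
  let f ← Prog.op .div 3 t2
  Prog.tabulate n fun i => Prog.op .mul f (total i)

end Algorithm

end Lewis

end

/-! The deterministic core rests on the variational form of leverage scores: `leverageScore M i`
bounds `(M x)_i² / ‖M x‖²` for every `x` with `M x ≠ 0` (`sq_mulVec_le`), and if it is nonzero some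
`x` attains it (`exists_direction`). Put `α = 1 - 2/p ∈ [0, 1]`, fix `x`, and let `b_j` be `(A
x)_j²` normalized to sum 1. An accurate step from `w` to `w'` then gives `w'_j ≥ (9/10) w_j^α b_j /
∑ w^α b`. For the average `z` of the iterates the claim becomes `z_i^α b_i ≤ (3/2) z_i ∑ z^α b`; the
scaling of `z` by 3/2 cancels inside the leverage score.

In logarithms the recursion is affine, so its sum over the `T` steps telescopes, and concavity of
`log` and of `y ↦ y^α` passes to the average. Each step loses at most 1/9, and a boundary term from
the last iterate remains. As `T ≥ 10 log n`, it is a small fraction of `T`, unless `α` is large and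
`b_i` is tiny; then the first iterate alone makes `z_i` large enough. The total stays below `2/5 ≤
log (3/2)`. See `averaging_of_logs`, `average_dominates` and `isLewisOverestimate_of_iterates`. No
contraction is needed, so every `p ≥ 2` is covered.

The sketched scores are averages of squared Rademacher sums with mean the true score. A comparison
with Gaussian exponential moments (`signAvg_exp_sq_le`) and a Chernoff potential that is a
supermartingale along the sketches (`signAvg_rowPotential_le`) bound the failure of one call by `2n
exp(-k/1000)`. A union bound over the `T` calls finishes the probability estimate; accuracy also
keeps the weights positive at nonzero rows, which makes the solver calls admissible. Costs are
bounded by structural recursion on programs. -/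

noncomputable section

namespace Lewis

/-! ### Averaging iterates along a fixed direction -/

/-- The abstract inequality behind the averaging step, with all quantities replaced by their
logarithms. -/
lemma averaging_of_logs {T : ℕ} (hT : 3 ≤ T) {α H ℓ v β t : ℝ}
    (hα0 : 0 ≤ α) (hα1 : α ≤ 1) (hH0 : 0 ≤ H) (hHT : 10 * H ≤ T)
    (x X l : ℕ → ℝ)
    (hx0 : -(1 / 9) + β ≤ x 0)
    (hx : ∀ k, k + 1 < T → -(1 / 9) + α * x k + β - l k ≤ x (k + 1))
    (hX0 : -(1 / 9) - H ≤ X 0)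
    (hX : ∀ k, k + 1 < T → -(1 / 9) + α * X k - H - l k ≤ X (k + 1))
    (hlX : ∀ k < T, α * X k ≤ l k)
    (hlx : ∀ k < T, α * x k + β ≤ l k)
    (hl : ∀ k < T, l k ≤ α / 10) (hx1 : ∀ k < T, x k ≤ 1 / 10)
    (hv : ∑ k ∈ Finset.range T, x k ≤ T * v)
    (hℓ : ∑ k ∈ Finset.range T, l k ≤ T * ℓ)
    (hℓX : α * ∑ k ∈ Finset.range T, X k ≤ T * ℓ)
    (hv0 : x 0 - t ≤ v) (ht : t ≤ T / 4 + 39 / 100) :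
    (α - 1) * v + β - ℓ ≤ 2 / 5 := by
  obtain ⟨m, rfl⟩ : ∃ m, T = m + 1 := ⟨T - 1, by omega⟩
  have hTR : (3 : ℝ) ≤ ((m + 1 : ℕ) : ℝ) := by exact_mod_cast hT
  set τ : ℝ := ((m + 1 : ℕ) : ℝ) with hτ
  -- Summing the recursion telescopes, except that the last value leaves the boundary term `l m - α
  -- * y m`.
  have key : ∀ (y : ℕ → ℝ) (γ : ℝ), -(1 / 9) + γ ≤ y 0 →
      (∀ k, k + 1 < m + 1 → -(1 / 9) + α * y k + γ - l k ≤ y (k + 1)) →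
      τ * (-(1 / 9) + γ) + (l m - α * y m) ≤
        (1 - α) * ∑ k ∈ Finset.range (m + 1), y k + ∑ k ∈ Finset.range (m + 1), l k := by
    intro y γ h0 h
    have h1 : ∑ k ∈ Finset.range m, (-(1 / 9) + α * y k + γ - l k) ≤
        ∑ k ∈ Finset.range m, y (k + 1) :=
      Finset.sum_le_sum fun k hk => h k (by simpa using hk)
    have h2 : ∑ k ∈ Finset.range m, (-(1 / 9) + α * y k + γ - l k) =
        m * (-(1 / 9) + γ) + α * ∑ k ∈ Finset.range m, y k - ∑ k ∈ Finset.range m, l k := by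
      rw [Finset.mul_sum, Finset.sum_sub_distrib, Finset.sum_add_distrib, Finset.sum_add_distrib]
      simp; ring
    have h3 := Finset.sum_range_succ' y m
    have h4 := Finset.sum_range_succ y m
    have h5 := Finset.sum_range_succ l m
    have h6 : τ = m + 1 := by simp [hτ]
    rw [h6, h5]
    linear_combination h0 + h1 - h2 - h3 + α * h4
  have kx := key x β hx0 hx
  have kX := key X (-H) (by linarith) (fun k hk => by have := hX k hk; linarith)
  have hm : m < m + 1 := Nat.lt_succ_self m
  -- In the first two cases below it thus suffices that `α * x m - l m ≤ (2/5 - 1/9) τ = (13/45) τ`.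
  have hf : τ * ((α - 1) * v + β - ℓ) ≤ τ / 9 + (α * x m - l m) := by
    have : (1 - α) * ∑ k ∈ Finset.range (m + 1), x k ≤ (1 - α) * (τ * v) :=
      mul_le_mul_of_nonneg_left hv (by linarith)
    linarith
  have conclude : ∀ {y : ℝ}, τ * y ≤ τ * (2 / 5) → y ≤ 2 / 5 := fun h =>
    le_of_mul_le_mul_left h (by linarith)
  rcases le_total α (3 / 5) with hα | hα
  -- Geometric series of ratio 3/5: `5/2 = 1 / (1 - 3/5)`, and `9/50` exceeds `1/9 + (3/5)/10`, the
  -- loss of one step beyond `H`.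
  · have hXk : ∀ k < m + 1, -(5 / 2) * (H + 9 / 50) ≤ X k := by
      intro k
      induction k with
      | zero => intro _; linarith
      | succ k ih =>
        intro hk
        have h1 := hX k hk
        have h2 := ih (by omega)
        have h3 := hl k (by omega)
        have h4 : α * (-(5 / 2) * (H + 9 / 50)) ≤ α * X k := mul_le_mul_of_nonneg_left h2 hα0
        have h5 : α * (H + 9 / 50) ≤ 3 / 5 * (H + 9 / 50) :=
          mul_le_mul_of_nonneg_right hα (by linarith)
        linarith
    have h1 := hlX m hm
    have h2 : α * (-(5 / 2) * (H + 9 / 50)) ≤ α * X m := mul_le_mul_of_nonneg_left (hXk m hm) hα0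
    have h5 : α * (H + 9 / 50) ≤ 3 / 5 * (H + 9 / 50) :=
      mul_le_mul_of_nonneg_right hα (by linarith)
    have h6 : α * x m ≤ α * (1 / 10) := mul_le_mul_of_nonneg_left (hx1 m hm) hα0
    apply conclude
    linarith
  -- The boundary term is at most `-β`, and `7/25 < 13/45`; so only a very negative `β` is left.
  · rcases le_total (-(7 / 25) * τ) β with hβ | hβ
    · have h1 := hlx m hm
      apply conclude
      linarith
    -- Here `β` is so negative that `v ≥ x 0 - t`, which keeps only the first term of the average,
    -- is enough. The coefficient of `τ` is at most `1/4 - (1/4 + 7/25 - 1/10) α`, negative for `α ≥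
    -- 3/5`.
    · have h1 := hlX m hm
      have h2 : α * (-(1 / 9) - H) ≤ ℓ := by
        have h3 : (1 - α) * (α * ∑ k ∈ Finset.range (m + 1), X k) ≤ (1 - α) * (τ * ℓ) :=
          mul_le_mul_of_nonneg_left hℓX (by linarith)
        have h4 : α * ∑ k ∈ Finset.range (m + 1), l k ≤ α * (τ * ℓ) :=
          mul_le_mul_of_nonneg_left hℓ hα0
        have h5 : α * (τ * (-(1 / 9) - H)) ≤ α * ((1 - α) * ∑ k ∈ Finset.range (m + 1), X k +
            ∑ k ∈ Finset.range (m + 1), l k) := mul_le_mul_of_nonneg_left (by linarith) hα0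
        have h6 : τ * (α * (-(1 / 9) - H)) ≤ τ * ℓ := by linarith
        exact le_of_mul_le_mul_left h6 (by linarith)
      have h3 : (1 - α) * (-(1 / 9) + β - t) ≤ (1 - α) * v :=
        mul_le_mul_of_nonneg_left (by linarith) (by linarith)
      have h4 : (1 - α) * t ≤ (1 - α) * (τ / 4 + 39 / 100) :=
        mul_le_mul_of_nonneg_left ht (by linarith)
      have h5 : α * β ≤ α * (-(7 / 25) * τ) := mul_le_mul_of_nonneg_left hβ hα0
      have h6 : α * H ≤ α * (τ / 10) := mul_le_mul_of_nonneg_left (by linarith) hα0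
      have h7 : 3 / 5 * τ ≤ α * τ := mul_le_mul_of_nonneg_right hα (by linarith)
      nlinarith

lemma sum_mul_log_le {ι : Type*} (s : Finset ι) (w y : ι → ℝ) (hw : ∀ i ∈ s, 0 ≤ w i)
    (hw1 : ∑ i ∈ s, w i = 1) (hy : ∀ i ∈ s, 0 < y i) :
    ∑ i ∈ s, w i * Real.log (y i) ≤ Real.log (∑ i ∈ s, w i * y i) := by
  simpa using strictConcaveOn_log_Ioi.concaveOn.le_map_sum hw hw1 hy

lemma two_fifths_le_log : (2 / 5 : ℝ) ≤ Real.log (3 / 2) := by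
  rw [Real.le_log_iff_exp_le (by norm_num)]
  refine (Real.exp_bound' (x := 2 / 5) (by norm_num) (by norm_num) (n := 5) (by norm_num)).trans ?_
  norm_num [Finset.sum_range_succ, Nat.factorial]

/-- If every vector `u (k + 1)` dominates, up to the factor `9 / 10`, the contributions of a fixed
direction to the leverage scores of the reweighting by `u k`, then the average of the vectors `u k`
dominates its own contributions up to the factor `3 / 2`. -/
theorem average_dominates {ι : Type*} (s : Finset ι) (b : ι → ℝ) (hb : ∀ j ∈ s, 0 < b j)
    (hb1 : ∑ j ∈ s, b j = 1) {n T : ℕ} (hT : 3 ≤ T)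
    (hnT : 10 * Real.log n ≤ T) (hcard : s.card ≤ n) {α : ℝ} (hα0 : 0 ≤ α) (hα1 : α ≤ 1)
    (u : ℕ → ι → ℝ) (hu : ∀ k < T, ∀ j ∈ s, 0 < u k j)
    (hu1 : ∀ k < T, ∀ j ∈ s, u k j ≤ 11 / 10)
    (hu0 : ∀ j ∈ s, 9 / 10 * b j ≤ u 0 j)
    (hstep : ∀ k, k + 1 < T → ∀ j ∈ s,
      9 / 10 * (u k j ^ α * b j) ≤ u (k + 1) j * ∑ j ∈ s, u k j ^ α * b j)
    (z : ι → ℝ) (hz : ∀ j, z j = (∑ k ∈ Finset.range T, u k j) / T) {i : ι} (hi : i ∈ s) :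
    z i ^ α * b i ≤ 3 / 2 * z i * ∑ j ∈ s, z j ^ α * b j := by
  have hs : s.Nonempty := ⟨i, hi⟩
  have hT0 : 0 < T := by omega
  have hTR : (0 : ℝ) < T := by exact_mod_cast hT0
  have hr : (Finset.range T).Nonempty := ⟨0, by simpa using hT0⟩
  have hlog9 : -(1 / 9 : ℝ) ≤ Real.log (9 / 10) := by
    have := Real.one_sub_inv_le_log_of_pos (x := 9 / 10) (by norm_num)
    norm_num at this ⊢; linarith
  have hlog11 : Real.log (11 / 10) ≤ 1 / 10 := by
    have := Real.log_le_sub_one_of_pos (x := 11 / 10) (by norm_num)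
    linarith
  -- Tangent line of `log` at 4, with `log 4 - 1 < 39/100`.
  have hlogT : Real.log T ≤ T / 4 + 39 / 100 := by
    have h1 := Real.log_le_sub_one_of_pos (x := (T : ℝ) / 4) (by positivity)
    rw [Real.log_div hTR.ne' (by norm_num),
      show (4 : ℝ) = 2 ^ 2 by norm_num, Real.log_pow] at h1
    have := Real.log_two_lt_d9
    push_cast at h1
    linarith
  have hzpos : ∀ j ∈ s, 0 < z j := fun j hj => by
    rw [hz]
    exact div_pos (Finset.sum_pos (fun k hk => hu k (by simpa using hk) j hj) hr) hTR
  have hNpos : ∀ y : ι → ℝ, (∀ j ∈ s, 0 < y j) → 0 < ∑ j ∈ s, y j ^ α * b j := fun y hy =>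
    Finset.sum_pos (fun j hj => mul_pos (Real.rpow_pos_of_pos (hy j hj) _) (hb j hj)) hs
  have hNlog : ∀ y : ι → ℝ, (∀ j ∈ s, 0 < y j) →
      α * ∑ j ∈ s, b j * Real.log (y j) ≤ Real.log (∑ j ∈ s, y j ^ α * b j) := fun y hy => by
    have := sum_mul_log_le s b (fun j => y j ^ α) (fun j hj => (hb j hj).le) hb1
      (fun j hj => Real.rpow_pos_of_pos (hy j hj) _)
    refine le_trans (le_of_eq ?_) (this.trans (le_of_eq ?_))
    · rw [Finset.mul_sum]
      refine Finset.sum_congr rfl fun j hj => ?_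
      rw [Real.log_rpow (hy j hj)]; ring
    · simp_rw [mul_comm]
  -- The entropy of `b` is at most the logarithm of the size of its support.
  have hH : -Real.log n ≤ ∑ j ∈ s, b j * Real.log (b j) := by
    have h1 := sum_mul_log_le s b (fun j => (b j)⁻¹) (fun j hj => (hb j hj).le) hb1
      (fun j hj => inv_pos.2 (hb j hj))
    have h2 : ∑ j ∈ s, b j * (b j)⁻¹ = s.card := by
      rw [Finset.sum_congr rfl fun j hj => mul_inv_cancel₀ (hb j hj).ne']; simp
    have h3 : Real.log s.card ≤ Real.log n :=
      Real.log_le_log (by exact_mod_cast hs.card_pos) (by exact_mod_cast hcard)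
    simp only [Real.log_inv, mul_neg, Finset.sum_neg_distrib] at h1
    rw [h2] at h1
    linarith
  have havg : ∀ y : ℕ → ℝ, (∀ k < T, 0 < y k) →
      ∑ k ∈ Finset.range T, Real.log (y k) ≤
        T * Real.log ((∑ k ∈ Finset.range T, y k) / T) := fun y hy => by
    have := sum_mul_log_le (Finset.range T) (fun _ => (T : ℝ)⁻¹) y (fun _ _ => by positivity)
      (by simp [hTR.ne']) (fun k hk => hy k (by simpa using hk))
    rw [← Finset.mul_sum, ← Finset.mul_sum, inv_mul_eq_div, inv_mul_eq_div, div_le_iff₀ hTR] at this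
    linarith
  have hx : ∀ j ∈ s, ∀ k, k + 1 < T → -(1 / 9) + α * Real.log (u k j) + Real.log (b j) -
      Real.log (∑ j ∈ s, u k j ^ α * b j) ≤ Real.log (u (k + 1) j) := fun j hj k hk => by
    have h1 := hu k (by omega) j hj
    have h2 := hNpos (u k) (hu k (by omega))
    have h3 := Real.log_le_log (mul_pos (by norm_num)
      (mul_pos (Real.rpow_pos_of_pos h1 _) (hb j hj))) (hstep k hk j hj)
    rw [Real.log_mul (by norm_num) (mul_pos (Real.rpow_pos_of_pos h1 _) (hb j hj)).ne',
      Real.log_mul (Real.rpow_pos_of_pos h1 _).ne' (hb j hj).ne', Real.log_rpow h1,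
      Real.log_mul (hu (k + 1) hk j hj).ne' h2.ne'] at h3
    linarith
  have hx0 : ∀ j ∈ s, -(1 / 9) + Real.log (b j) ≤ Real.log (u 0 j) := fun j hj => by
    have h3 := Real.log_le_log (mul_pos (by norm_num) (hb j hj)) (hu0 j hj)
    rw [Real.log_mul (by norm_num) (hb j hj).ne'] at h3
    linarith
  have hxle : ∀ k < T, ∀ j ∈ s, Real.log (u k j) ≤ 1 / 10 := fun k hk j hj =>
    (Real.log_le_log (hu k hk j hj) (hu1 k hk j hj)).trans hlog11
  have main := averaging_of_logs hT hα0 hα1 (H := Real.log n)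
    (ℓ := Real.log (∑ j ∈ s, z j ^ α * b j)) (v := Real.log (z i)) (β := Real.log (b i))
    (t := Real.log T) (Real.log_natCast_nonneg n) hnT
    (fun k => Real.log (u k i)) (fun k => ∑ j ∈ s, b j * Real.log (u k j))
    (fun k => Real.log (∑ j ∈ s, u k j ^ α * b j)) (hx0 i hi) (hx i hi)
    (by
      have := Finset.sum_le_sum fun j hj => mul_le_mul_of_nonneg_left (hx0 j hj) (hb j hj).le
      simp only [mul_add, Finset.sum_add_distrib, ← Finset.sum_mul, hb1] at this
      linarith)
    (fun k hk => by
      have := Finset.sum_le_sum fun j hj => mul_le_mul_of_nonneg_left (hx j hj k hk) (hb j hj).le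
      simp only [mul_add, mul_sub, Finset.sum_add_distrib, Finset.sum_sub_distrib,
        ← Finset.sum_mul, hb1, mul_left_comm _ α, ← Finset.mul_sum] at this
      linarith)
    (fun k hk => hNlog _ (hu k hk))
    (fun k hk => by
      have h1 := Real.rpow_pos_of_pos (hu k hk i hi) α
      rw [← Real.log_rpow (hu k hk i hi), ← Real.log_mul h1.ne' (hb i hi).ne']
      refine Real.log_le_log (mul_pos h1 (hb i hi)) ?_
      exact Finset.single_le_sum (f := fun j => u k j ^ α * b j) (fun j hj =>
        mul_nonneg (Real.rpow_nonneg (hu k hk j hj).le _) (hb j hj).le) hi)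
    (fun k hk => by
      have h1 : ∑ j ∈ s, u k j ^ α * b j ≤ (11 / 10) ^ α := by
        calc _ ≤ ∑ j ∈ s, (11 / 10 : ℝ) ^ α * b j := Finset.sum_le_sum fun j hj =>
              mul_le_mul_of_nonneg_right
                (Real.rpow_le_rpow (hu k hk j hj).le (hu1 k hk j hj) hα0) (hb j hj).le
          _ = _ := by rw [← Finset.mul_sum, hb1, mul_one]
      have h2 := Real.log_le_log (hNpos _ (hu k hk)) h1
      rw [Real.log_rpow (by norm_num)] at h2
      have := mul_le_mul_of_nonneg_left hlog11 hα0
      linarith)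
    (fun k hk => hxle k hk i hi)
    (by rw [hz]; exact havg _ fun k hk => hu k hk i hi)
    (by
      -- Concavity is used twice: of `log` over the steps, then of `y ↦ y^α` in each coordinate.
      refine (havg _ fun k hk => hNpos _ (hu k hk)).trans ?_
      refine mul_le_mul_of_nonneg_left (Real.log_le_log (div_pos (Finset.sum_pos
        (fun k hk => hNpos _ (hu k (by simpa using hk))) hr) hTR) ?_) hTR.le
      rw [Finset.sum_comm, Finset.sum_div]
      refine Finset.sum_le_sum fun j hj => ?_
      rw [← Finset.sum_mul, mul_div_right_comm]
      refine mul_le_mul_of_nonneg_right ?_ (hb j hj).le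
      have := (Real.concaveOn_rpow hα0 hα1).le_map_sum (t := Finset.range T)
        (w := fun _ => (T : ℝ)⁻¹) (p := fun k => u k j) (fun _ _ => by positivity)
        (by simp [hTR.ne']) (fun k hk => (hu k (by simpa using hk) j hj).le)
      simp only [smul_eq_mul, inv_mul_eq_div, ← Finset.sum_div] at this
      rwa [hz])
    (by
      refine le_trans ?_ (mul_le_mul_of_nonneg_left (hNlog z hzpos) hTR.le)
      rw [mul_left_comm]
      refine mul_le_mul_of_nonneg_left ?_ hα0
      rw [Finset.sum_comm, Finset.mul_sum]
      refine Finset.sum_le_sum fun j hj => ?_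
      rw [← Finset.mul_sum, mul_left_comm, hz]
      exact mul_le_mul_of_nonneg_left (havg _ fun k hk => hu k hk j hj) (hb j hj).le)
    (by
      rw [← Real.log_div (hu 0 hT0 i hi).ne' hTR.ne']
      refine Real.log_le_log (div_pos (hu 0 hT0 i hi) hTR) ?_
      rw [hz]
      exact div_le_div_of_nonneg_right (Finset.single_le_sum (f := fun k => u k i)
        (fun k hk => (hu k (by simpa using hk) i hi).le) (by simpa using hT0)) hTR.le)
    hlogT
  have hzi := hzpos i hi
  have hN := hNpos z hzpos
  have hp := Real.rpow_pos_of_pos hzi α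
  rw [← Real.log_le_log_iff (mul_pos hp (hb i hi)) (by positivity),
    Real.log_mul hp.ne' (hb i hi).ne', Real.log_rpow hzi, Real.log_mul (by positivity) hN.ne',
    Real.log_mul (by norm_num) hzi.ne']
  have := two_fifths_le_log
  linarith

/-! ### Leverage scores as diagonal entries of a projection -/

section
open Matrix

variable {n d : ℕ}

/-- The orthogonal projection `M (Mᵀ M)⁻¹ Mᵀ` onto the column space of `M`. -/
def proj (M : Matrix (Fin n) (Fin d) ℝ) : Matrix (Fin n) (Fin n) ℝ :=
  M * (Mᵀ * M)⁻¹ * Mᵀ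

lemma leverageScore_eq_proj (M : Matrix (Fin n) (Fin d) ℝ) (i : Fin n) :
    leverageScore M i = proj M i i := by
  change (M *ᵥ ((Mᵀ * M)⁻¹ *ᵥ M i)) i = _
  rw [Matrix.mulVec_mulVec]
  rfl

lemma proj_transpose (M : Matrix (Fin n) (Fin d) ℝ) : (proj M)ᵀ = proj M := by
  simp [proj, Matrix.transpose_mul, Matrix.transpose_nonsing_inv, Matrix.mul_assoc]

variable {M : Matrix (Fin n) (Fin d) ℝ}

lemma proj_mul_self (hM : IsUnit (Mᵀ * M)) : proj M * M = M := by
  rw [proj, Matrix.mul_assoc, Matrix.mul_assoc,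
    Matrix.nonsing_inv_mul _ ((Matrix.isUnit_iff_isUnit_det _).1 hM), Matrix.mul_one]

lemma proj_mul_proj (hM : IsUnit (Mᵀ * M)) : proj M * proj M = proj M := by
  nth_rw 2 [proj]
  rw [← Matrix.mul_assoc, ← Matrix.mul_assoc, proj_mul_self hM, proj]

lemma sum_sq_proj (hM : IsUnit (Mᵀ * M)) (i : Fin n) :
    ∑ j, proj M i j ^ 2 = leverageScore M i := by
  rw [leverageScore_eq_proj]
  nth_rw 2 [← proj_mul_proj hM]
  rw [Matrix.mul_apply]
  refine Finset.sum_congr rfl fun j _ => ?_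
  rw [sq]
  nth_rw 4 [← proj_transpose]
  rfl

lemma leverageScore_nonneg (hM : IsUnit (Mᵀ * M)) (i : Fin n) : 0 ≤ leverageScore M i := by
  rw [← sum_sq_proj hM]
  positivity

/-- The diagonal entry `σ` of a projection is the squared norm of its row, which contains `σ`
itself; so `σ² ≤ σ`. -/
lemma leverageScore_le_one (hM : IsUnit (Mᵀ * M)) (i : Fin n) : leverageScore M i ≤ 1 := by
  have h : leverageScore M i ^ 2 ≤ leverageScore M i := by
    nth_rw 2 [← sum_sq_proj hM]
    rw [leverageScore_eq_proj]
    exact Finset.single_le_sum (f := fun j => proj M i j ^ 2) (fun _ _ => sq_nonneg _)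
      (Finset.mem_univ i)
  by_contra hlt
  nlinarith

lemma sum_leverageScore (hM : IsUnit (Mᵀ * M)) : ∑ i, leverageScore M i = d := by
  simp_rw [leverageScore_eq_proj]
  change Matrix.trace (proj M) = d
  rw [proj, Matrix.trace_mul_comm, ← Matrix.mul_assoc,
    Matrix.mul_nonsing_inv _ ((Matrix.isUnit_iff_isUnit_det _).1 hM)]
  simp

/-- The projection fixes `M x`; apply Cauchy–Schwarz to its `i`-th row, whose squared norm is the
leverage score. -/
lemma sq_mulVec_le (hM : IsUnit (Mᵀ * M)) (x : Fin d → ℝ) (i : Fin n) :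
    (M *ᵥ x) i ^ 2 ≤ leverageScore M i * ∑ j, (M *ᵥ x) j ^ 2 := by
  have h : (M *ᵥ x) i = ∑ j, proj M i j * (M *ᵥ x) j := by
    conv_lhs => rw [← proj_mul_self hM, ← Matrix.mulVec_mulVec]
    rfl
  rw [h, ← sum_sq_proj hM]
  exact Finset.sum_mul_sq_le_sq_mul_sq _ _ _

/-- Equality case of Cauchy–Schwarz: `M x` is the `i`-th row of the projection. -/
lemma exists_direction (hM : IsUnit (Mᵀ * M)) (i : Fin n) :
    ∃ x : Fin d → ℝ, (M *ᵥ x) i = leverageScore M i ∧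
      ∑ j, (M *ᵥ x) j ^ 2 = leverageScore M i := by
  have h : ∀ j, (M *ᵥ ((Mᵀ * M)⁻¹ *ᵥ M i)) j = proj M i j := fun j => by
    rw [← proj_transpose, Matrix.transpose_apply, proj, Matrix.mulVec_mulVec]
    rfl
  exact ⟨(Mᵀ * M)⁻¹ *ᵥ M i, by rw [h, leverageScore_eq_proj],
    by simp_rw [h, sum_sq_proj hM]⟩

/-! ### Rescaled rows -/

variable {A : Matrix (Fin n) (Fin d) ℝ}

lemma transpose_mul_diagonal_mul (s : Fin n → ℝ) :
    (diagonal s * A)ᵀ * (diagonal s * A) = Aᵀ * diagonal (fun i => s i * s i) * A := by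
  simp only [Matrix.transpose_mul, Matrix.diagonal_transpose, Matrix.mul_assoc]
  rw [← Matrix.mul_assoc (diagonal s), Matrix.diagonal_mul_diagonal]

lemma diagonal_mul_mulVec (s : Fin n → ℝ) (x : Fin d → ℝ) (i : Fin n) :
    ((diagonal s * A) *ᵥ x) i = s i * (A *ᵥ x) i := by
  rw [← Matrix.mulVec_mulVec, Matrix.mulVec_diagonal]

lemma proj_mulVec (s q : Fin n → ℝ) (i : Fin n) :
    (proj (diagonal s * A) *ᵥ q) i =
      s i * (A *ᵥ ((Aᵀ * diagonal (fun i => s i * s i) * A)⁻¹ *ᵥ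
        (Aᵀ *ᵥ fun i => s i * q i))) i := by
  have h : diagonal s *ᵥ q = fun i => s i * q i := by
    ext i; rw [Matrix.mulVec_diagonal]
  rw [← diagonal_mul_mulVec, ← transpose_mul_diagonal_mul, ← h, proj]
  simp only [Matrix.mulVec_mulVec, Matrix.transpose_mul, Matrix.diagonal_transpose,
    Matrix.mul_assoc]

lemma isUnit_of_rank (hA : A.rank = d) {s : Fin n → ℝ} (hs : ∀ i, A i ≠ 0 → s i ≠ 0) :
    IsUnit ((diagonal s * A)ᵀ * (diagonal s * A)) := by
  rw [← Matrix.mulVec_injective_iff_isUnit]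
  have hinj : Function.Injective A.mulVecLin := by
    rw [← LinearMap.ker_eq_bot]
    have := A.mulVecLin.finrank_range_add_finrank_ker
    rw [Module.finrank_fin_fun] at this
    rw [Matrix.rank] at hA
    exact Submodule.finrank_eq_zero.1 (by omega)
  change Function.Injective (Matrix.mulVecLin _)
  rw [← LinearMap.ker_eq_bot, Matrix.ker_mulVecLin_transpose_mul_self, LinearMap.ker_eq_bot']
  intro x hx
  refine hinj (Eq.trans ?_ (map_zero A.mulVecLin).symm)
  ext i
  have h := congrFun hx i
  rw [Matrix.mulVecLin_apply, diagonal_mul_mulVec] at h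
  rcases mul_eq_zero.1 h with h | h
  · have : A i = 0 := by by_contra h0; exact hs i h0 h
    simp [Matrix.mulVec, this]
  · exact h

/-- The row `A i` itself serves as test direction. -/
lemma leverageScore_pos (hA : A.rank = d) {s : Fin n → ℝ} (hs : ∀ i, A i ≠ 0 → s i ≠ 0)
    {i : Fin n} (hi : A i ≠ 0) : 0 < leverageScore (diagonal s * A) i := by
  have hM := isUnit_of_rank hA hs
  refine (leverageScore_nonneg hM i).lt_of_ne fun h0 => ?_
  have h1 : A i ⬝ᵥ A i ≠ 0 := fun h => hi (dotProduct_self_eq_zero.1 h)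
  have h2 := sq_mulVec_le hM (A i) i
  rw [← h0, zero_mul, diagonal_mul_mulVec] at h2
  exact (mul_ne_zero (hs i hi) h1) (pow_eq_zero_iff two_ne_zero |>.1 (le_antisymm h2 (sq_nonneg _)))

/-! ### The approximate fixed-point iteration -/

/-- `v` approximates the leverage scores of `W^{1/2 - 1/p} A` up to a factor `1 ± 1/10`. -/
def ApproxScores (A : Matrix (Fin n) (Fin d) ℝ) (p : ℝ) (w v : Fin n → ℝ) : Prop :=
  ∀ i, 9 / 10 * leverageScore (reweight w p A) i ≤ v i ∧
    v i ≤ 11 / 10 * leverageScore (reweight w p A) i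

lemma rpow_half_sub_ne_zero {w : Fin n → ℝ} (hw : ∀ i, A i ≠ 0 → 0 < w i) (e : ℝ) (i : Fin n)
    (hi : A i ≠ 0) : w i ^ e ≠ 0 :=
  (Real.rpow_pos_of_pos (hw i hi) _).ne'

lemma isUnit_reweight (hA : A.rank = d) {w : Fin n → ℝ} (hw : ∀ i, A i ≠ 0 → 0 < w i) (p : ℝ) :
    IsUnit ((reweight w p A)ᵀ * reweight w p A) :=
  isUnit_of_rank hA (rpow_half_sub_ne_zero hw _)

lemma ApproxScores.pos (hA : A.rank = d) {p : ℝ} {w v : Fin n → ℝ}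
    (hw : ∀ i, A i ≠ 0 → 0 < w i) (h : ApproxScores A p w v) (i : Fin n) (hi : A i ≠ 0) :
    0 < v i := by
  have : 0 < leverageScore (reweight w p A) i :=
    leverageScore_pos hA (rpow_half_sub_ne_zero hw _) hi
  linarith [(h i).1]

lemma ApproxScores.nonneg (hA : A.rank = d) {p : ℝ} {w v : Fin n → ℝ}
    (hw : ∀ i, A i ≠ 0 → 0 < w i) (h : ApproxScores A p w v) (i : Fin n) : 0 ≤ v i := by
  have := leverageScore_nonneg (isUnit_reweight hA hw p) i
  linarith [(h i).1]

lemma iterates_pos (hA : A.rank = d) {p : ℝ} {T : ℕ} {w : ℕ → Fin n → ℝ}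
    (h0 : ∀ i, A i ≠ 0 → 0 < w 0 i) (h : ∀ k < T, ApproxScores A p (w k) (w (k + 1))) :
    ∀ k ≤ T, ∀ i, A i ≠ 0 → 0 < w k i
  | 0, _ => h0
  | k + 1, hk => (h k hk).pos hA (iterates_pos hA h0 h k (by omega))

lemma sq_reweight_mulVec {w : Fin n → ℝ} {i : Fin n} (hw : 0 ≤ w i) (p : ℝ) (x : Fin d → ℝ) :
    (reweight w p A *ᵥ x) i ^ 2 = w i ^ (1 - 2 / p) * (A *ᵥ x) i ^ 2 := by
  rw [reweight, diagonal_mul_mulVec, mul_pow, ← Real.rpow_mul_natCast hw]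
  congr 2
  push_cast
  ring

lemma rpow_mul_sq_le (hA : A.rank = d) {w : Fin n → ℝ} (hw : ∀ i, A i ≠ 0 → 0 < w i)
    (hw0 : ∀ i, 0 ≤ w i) (p : ℝ) (x : Fin d → ℝ) (i : Fin n) :
    w i ^ (1 - 2 / p) * (A *ᵥ x) i ^ 2 ≤
      leverageScore (reweight w p A) i * ∑ j, w j ^ (1 - 2 / p) * (A *ᵥ x) j ^ 2 := by
  have := sq_mulVec_le (isUnit_reweight hA hw p) x i
  simpa only [fun j => sq_reweight_mulVec (A := A) (hw0 j) p x] using this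

/-- The averaged iterates of the approximate fixed-point iteration, scaled by `3 / 2`, are Lewis
weight overestimates. -/
theorem isLewisOverestimate_of_iterates (hA : A.rank = d) {p : ℝ} (hp : 2 ≤ p) {T : ℕ}
    (hT : 3 ≤ T) (hnT : 10 * Real.log n ≤ T) {w : ℕ → Fin n → ℝ} {a : ℝ}
    (ha : w 0 = fun _ => a) (ha0 : ∀ i, A i ≠ 0 → 0 < a) (ha1 : 0 ≤ a)
    (h : ∀ k < T, ApproxScores A p (w k) (w (k + 1))) :
    IsLewisOverestimate A p fun i => 3 / (2 * T) * ∑ k ∈ Finset.range T, w (k + 1) i := by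
  have hTR : (3 : ℝ) ≤ T := by exact_mod_cast hT
  have hpos := iterates_pos hA (T := T) (p := p) (w := w) (by simpa [ha] using ha0) h
  have hnn : ∀ k ≤ T, ∀ i, 0 ≤ w k i := by
    intro k hk i
    cases k with
    | zero => simpa [ha] using ha1
    | succ k => exact (h k hk).nonneg hA (hpos k (by omega)) i
  set α : ℝ := 1 - 2 / p with hα
  have hα0 : 0 ≤ α := by
    rw [hα, sub_nonneg, div_le_one (by linarith)]; exact hp
  have hα1 : α ≤ 1 := by
    have : 0 ≤ 2 / p := by positivity
    linarith
  set z : Fin n → ℝ := fun i => (∑ k ∈ Finset.range T, w (k + 1) i) / T with hz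
  have hwz : (fun i => 3 / (2 * T) * ∑ k ∈ Finset.range T, w (k + 1) i) =
      fun i => 3 / 2 * z i := by
    ext i; simp only [hz]; field_simp
  rw [hwz]
  have hz0 : ∀ i, 0 ≤ z i := fun i => div_nonneg (Finset.sum_nonneg fun k hk =>
    hnn _ (by have := Finset.mem_range.1 hk; omega) i) (by linarith)
  have hzpos : ∀ i, A i ≠ 0 → 0 < z i := fun i hi => div_pos (Finset.sum_pos (fun k hk =>
    hpos _ (by have := Finset.mem_range.1 hk; omega) i hi) ⟨0, by simp; omega⟩) (by linarith)
  have hv0 : ∀ i, 0 ≤ 3 / 2 * z i := fun i => by linarith [hz0 i]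
  have hvpos : ∀ i, A i ≠ 0 → 0 < 3 / 2 * z i := fun i hi => by linarith [hzpos i hi]
  have hunit : ∀ k < T, IsUnit ((reweight (w k) p A)ᵀ * reweight (w k) p A) := fun k hk =>
    isUnit_reweight hA (hpos k hk.le) p
  have hsum : ∑ i, |3 / 2 * z i| = 3 / 2 * ((∑ k ∈ Finset.range T, ∑ i, w (k + 1) i) / T) := by
    rw [Finset.sum_congr rfl fun i _ => abs_of_nonneg (hv0 i), ← Finset.mul_sum, ← Finset.sum_div,
      Finset.sum_comm]
  have hd : (0 : ℝ) ≤ d := by positivity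
  -- True scores sum to `d`, so the scaled average has mass between `(3/2)(9/10) d` and
  -- `(3/2)(11/10) d`.
  refine ⟨hv0, ?_, ?_, isUnit_reweight hA hvpos p, ?_⟩
  · rw [hsum]
    have : ∑ _k ∈ Finset.range T, (9 / 10 * d : ℝ) ≤
        ∑ k ∈ Finset.range T, ∑ i, w (k + 1) i := by
      refine Finset.sum_le_sum fun k hk => ?_
      have hk := Finset.mem_range.1 hk
      rw [← sum_leverageScore (hunit k hk), Finset.mul_sum]
      exact Finset.sum_le_sum fun i _ => (h k hk i).1
    rw [Finset.sum_const, Finset.card_range, nsmul_eq_mul] at this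
    have h2 : 9 / 10 * (d : ℝ) ≤ (∑ k ∈ Finset.range T, ∑ i, w (k + 1) i) / T := by
      rw [le_div_iff₀ (by linarith)]; linarith
    linarith
  · rw [hsum]
    have : ∑ k ∈ Finset.range T, ∑ i, w (k + 1) i ≤
        ∑ _k ∈ Finset.range T, (11 / 10 * d : ℝ) := by
      refine Finset.sum_le_sum fun k hk => ?_
      have hk := Finset.mem_range.1 hk
      rw [← sum_leverageScore (hunit k hk), Finset.mul_sum]
      exact Finset.sum_le_sum fun i _ => (h k hk i).2
    rw [Finset.sum_const, Finset.card_range, nsmul_eq_mul] at this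
    have h2 : (∑ k ∈ Finset.range T, ∑ i, w (k + 1) i) / T ≤ 11 / 10 * (d : ℝ) := by
      rw [div_le_iff₀ (by linarith)]; linarith
    linarith
  · intro i
    set σ := leverageScore (reweight (fun i => 3 / 2 * z i) p A) i with hσ
    -- For this `x` both the `i`-th coordinate and the squared norm equal `σ`. The averaging
    -- inequality then reads `σ * σ ≤ 3/2 * z i * σ`.
    obtain ⟨x, hx1, hx2⟩ := exists_direction (isUnit_reweight hA hvpos p) i
    rw [← hσ] at hx1 hx2
    have hσ0 : 0 ≤ σ := leverageScore_nonneg (isUnit_reweight hA hvpos p) i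
    rcases hσ0.eq_or_lt with h0 | hσpos
    · rw [← h0]; exact hv0 i
    set y : Fin n → ℝ := fun j => (A *ᵥ x) j ^ 2 with hy
    have hy0 : ∀ j, 0 ≤ y j := fun j => sq_nonneg _
    have hc : (0 : ℝ) < (3 / 2) ^ α := by positivity
    have hterm : ∀ j, (reweight (fun i => 3 / 2 * z i) p A *ᵥ x) j ^ 2 =
        (3 / 2) ^ α * (z j ^ α * y j) := fun j => by
      rw [sq_reweight_mulVec (hv0 j), ← hα, Real.mul_rpow (by norm_num) (hz0 j), mul_assoc]
    have hi2 : σ ^ 2 = (3 / 2) ^ α * (z i ^ α * y i) := by rw [← hx1, hterm]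
    have hN : σ = (3 / 2) ^ α * ∑ j, z j ^ α * y j := by
      rw [← hx2, Finset.mul_sum]; exact Finset.sum_congr rfl fun j _ => hterm j
    have hyi : 0 < y i := (hy0 i).lt_of_ne fun h0 => by
      rw [← h0] at hi2
      have : 0 < σ ^ 2 := by positivity
      simp [hi2] at this
    -- Restricting to the support of `y` makes all logarithms meaningful; rows outside it contribute
    -- nothing to the sums.
    set S : Finset (Fin n) := Finset.univ.filter fun j => y j ≠ 0 with hS
    have hiS : i ∈ S := by simp [hS, hyi.ne']
    have hSpos : ∀ j ∈ S, 0 < y j := fun j hj =>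
      (hy0 j).lt_of_ne' (by simpa [hS] using hj)
    have hSA : ∀ j ∈ S, A j ≠ 0 := fun j hj h0 => (hSpos j hj).ne' (by simp [hy, mulVec, h0])
    have hSsum : ∀ f : Fin n → ℝ, ∑ j ∈ S, f j * y j = ∑ j, f j * y j := fun f => by
      rw [hS, Finset.sum_filter]
      refine Finset.sum_congr rfl fun j _ => ?_
      split_ifs with hj
      · rfl
      · simp [not_not.1 hj]
    set B := ∑ j ∈ S, y j with hB
    have hBpos : 0 < B := Finset.sum_pos hSpos ⟨i, hiS⟩
    have hBu : B = ∑ j, y j := by simpa using hSsum fun _ => 1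
    have hdiv : ∀ f : Fin n → ℝ, ∑ j ∈ S, f j * (y j / B) = (∑ j, f j * y j) / B := fun f => by
      rw [← hSsum, Finset.sum_div]
      exact Finset.sum_congr rfl fun j _ => (mul_div_assoc _ _ _).symm
    have key := average_dominates S (fun j => y j / B) (fun j hj => div_pos (hSpos j hj) hBpos)
      (by rw [← Finset.sum_div, div_self hBpos.ne']) hT hnT
      -- The averaged sequence begins with `w 1`; the uniform start `w 0` enters only through the
      -- lower bound on `w 1`.
      (by simpa using Finset.card_le_univ S) hα0 hα1 (fun k => w (k + 1))
      (fun k hk j hj => hpos (k + 1) hk j (hSA j hj))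
      (fun k hk j _ => by
        have := leverageScore_le_one (hunit k hk) j
        linarith [(h k hk j).2])
      (fun j _ => by
        have h1 := rpow_mul_sq_le hA (hpos 0 (by omega)) (hnn 0 (by omega)) p x j
        have h2 := (h 0 (by omega) j).1
        by_cases hj : A j = 0
        · have : y j = 0 := by simp [hy, mulVec, hj]
          rw [this]
          simpa using hnn 1 (by omega) j
        simp only [← hα, fun j => congrFun ha j, ← Finset.mul_sum] at h1
        -- Since the start is uniform, its power `a ^ α` cancels from both sides.
        have ha2 : 0 < a ^ α := Real.rpow_pos_of_pos (ha0 j hj) _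
        have h3 : y j ≤ leverageScore (reweight (w 0) p A) j * B := by
          rw [hBu]
          refine le_of_mul_le_mul_left (a := a ^ α) ?_ ha2
          linarith
        rw [← div_le_iff₀ hBpos] at h3
        change 9 / 10 * (y j / B) ≤ w (0 + 1) j
        linarith)
      (fun k hk j _ => by
        have h1 := rpow_mul_sq_le hA (hpos (k + 1) (by omega)) (hnn (k + 1) (by omega)) p x j
        have h2 := (h (k + 1) hk j).1
        have h3 : 0 ≤ ∑ j, w (k + 1) j ^ α * y j := Finset.sum_nonneg fun j _ =>
          mul_nonneg (Real.rpow_nonneg (hnn (k + 1) (by omega) j) _) (hy0 j)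
        have h4 := mul_le_mul_of_nonneg_right h2 h3
        rw [hdiv, ← mul_div_assoc, ← mul_div_assoc, ← mul_div_assoc]
        refine div_le_div_of_nonneg_right ?_ hBpos.le
        rw [← hα] at h1
        simp only [hy] at h4 ⊢
        linarith)
      z (fun _ => rfl) hiS
    rw [hdiv, ← mul_div_assoc, ← mul_div_assoc, div_le_div_iff_of_pos_right hBpos] at key
    have h5 := mul_le_mul_of_nonneg_left key hc.le
    have h6 : σ * σ ≤ 3 / 2 * z i * σ := by
      calc σ * σ = (3 / 2) ^ α * (z i ^ α * y i) := by rw [← hi2, sq]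
        _ ≤ _ := h5
        _ = 3 / 2 * z i * ((3 / 2) ^ α * ∑ j, z j ^ α * y j) := by ring
        _ = _ := by rw [← hN]
    exact le_of_mul_le_mul_right h6 hσpos

end

/-! ### Exponential moments of squared Rademacher sums -/

section

variable {n : ℕ}

/-- The sign vector given by a sequence of bits. -/
def signVec (q : Fin n → Bool) : Fin n → ℝ := fun i => if q i then 1 else -1

/-- The average of a function over all sign vectors. -/
def signAvg (f : (Fin n → ℝ) → ℝ) : ℝ :=
  (∑ q : Fin n → Bool, f (signVec q)) / 2 ^ n

lemma signAvg_const (a : ℝ) : signAvg (n := n) (fun _ => a) = a := by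
  simp [signAvg]

lemma signAvg_mono {f g : (Fin n → ℝ) → ℝ} (h : ∀ q, f q ≤ g q) : signAvg f ≤ signAvg g :=
  div_le_div_of_nonneg_right (Finset.sum_le_sum fun q _ => h _) (by positivity)

lemma signAvg_add (f g : (Fin n → ℝ) → ℝ) :
    signAvg (fun q => f q + g q) = signAvg f + signAvg g := by
  simp [signAvg, Finset.sum_add_distrib, add_div]

lemma signAvg_const_mul (a : ℝ) (f : (Fin n → ℝ) → ℝ) :
    signAvg (fun q => a * f q) = a * signAvg f := by
  simp [signAvg, ← Finset.mul_sum, mul_div_assoc]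

lemma signAvg_sum {ι : Type*} (s : Finset ι) (f : ι → (Fin n → ℝ) → ℝ) :
    signAvg (fun q => ∑ i ∈ s, f i q) = ∑ i ∈ s, signAvg (f i) := by
  simp only [signAvg]
  rw [Finset.sum_comm, Finset.sum_div]

lemma signAvg_prod (f : Fin n → ℝ → ℝ) :
    signAvg (fun q => ∏ i, f i (q i)) = ∏ i, ((f i 1 + f i (-1)) / 2) := by
  rw [signAvg, Finset.prod_div_distrib]
  congr 1
  · have := Finset.prod_univ_sum (fun _ : Fin n => (Finset.univ : Finset Bool))
      (fun i b => f i (if b then 1 else -1))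
    rw [Fintype.piFinset_univ] at this
    simpa [signVec] using this.symm
  · simp

lemma signAvg_exp_le (v : Fin n → ℝ) :
    signAvg (fun q => Real.exp (∑ i, v i * q i)) ≤ Real.exp ((∑ i, v i ^ 2) / 2) := by
  simp_rw [Real.exp_sum]
  rw [signAvg_prod fun i t => Real.exp (v i * t), Finset.sum_div, Real.exp_sum]
  refine Finset.prod_le_prod (fun i _ => by positivity) fun i _ => ?_
  simpa [Real.cosh_eq] using Real.cosh_le_exp_half_sq (v i)

lemma signAvg_mul_eq (i j : Fin n) : signAvg (fun q => q i * q j) = if i = j then 1 else 0 := by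
  split_ifs with h
  · subst h
    have : ∀ q : Fin n → Bool, signVec q i * signVec q i = 1 := fun q => by
      by_cases hq : q i <;> simp [signVec, hq]
    simp [signAvg, this]
  · have h1 := signAvg_prod fun l (t : ℝ) =>
      (if l = i then t else 1) * (if l = j then t else 1)
    have h2 : ∏ l, ((((if l = i then (1 : ℝ) else 1) * (if l = j then 1 else 1)) +
        ((if l = i then (-1 : ℝ) else 1) * (if l = j then -1 else 1))) / 2) = 0 :=
      Finset.prod_eq_zero (Finset.mem_univ i) (by simp [h])
    rw [h2] at h1
    simpa only [Finset.prod_mul_distrib, Finset.prod_ite_eq', Finset.mem_univ, if_true] using h1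

lemma signAvg_sq (v : Fin n → ℝ) :
    signAvg (fun q => (∑ i, v i * q i) ^ 2) = ∑ i, v i ^ 2 := by
  have : ∀ q : Fin n → ℝ, (∑ i, v i * q i) ^ 2 = ∑ i, ∑ j, (v i * v j) * (q i * q j) := fun q => by
    rw [sq, Finset.sum_mul_sum]
    exact Finset.sum_congr rfl fun i _ => Finset.sum_congr rfl fun j _ => by ring
  simp_rw [this, signAvg_sum, signAvg_const_mul, signAvg_mul_eq]
  simp [sq]

lemma integrable_exp_quadratic (a : ℝ) :
    MeasureTheory.Integrable fun x : ℝ => Real.exp (a * x - x ^ 2 / 2) := by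
  have h := (integrable_exp_neg_mul_sq (b := 1 / 2) (by norm_num)).comp_sub_right a
  refine (h.const_mul (Real.exp (a ^ 2 / 2))).congr (Filter.Eventually.of_forall fun x => ?_)
  simp only [← Real.exp_add]
  congr 1; ring

lemma integral_exp_quadratic (a : ℝ) :
    ∫ x : ℝ, Real.exp (a * x - x ^ 2 / 2) = Real.exp (a ^ 2 / 2) * √(2 * Real.pi) := by
  have h : ∀ x : ℝ, Real.exp (a * x - x ^ 2 / 2) =
      Real.exp (a ^ 2 / 2) * Real.exp (-(1 / 2) * (x - a) ^ 2) := fun x => by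
    rw [← Real.exp_add]; congr 1; ring
  simp_rw [h]
  rw [MeasureTheory.integral_const_mul,
    MeasureTheory.integral_sub_right_eq_self (fun x => Real.exp (-(1 / 2) * x ^ 2)),
    integral_gaussian]
  congr 2; ring

/-- The exponential moment of the square of a normalized Rademacher sum is at most that of the
square of a standard Gaussian. -/
lemma signAvg_exp_sq_le {v : Fin n → ℝ} (hv : ∑ i, v i ^ 2 = 1) {θ : ℝ} (h0 : 0 ≤ θ)
    (h1 : θ < 1) :
    signAvg (fun q => Real.exp (θ * (∑ i, v i * q i) ^ 2 / 2)) ≤ (√(1 - θ))⁻¹ := by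
  have hpi : 0 < √(2 * Real.pi) := by positivity
  have hθ : √θ ^ 2 = θ := Real.sq_sqrt h0
  have hb : (0 : ℝ) < (1 - θ) / 2 := by linarith
  -- Gaussian linearization: `exp (θ X² / 2)` is the Gaussian average of `exp (√θ X g)`. After
  -- exchanging the averages, the subgaussian bound for the signs leaves the Gaussian average of
  -- `exp (θ g² / 2)`.
  have key : signAvg (fun q => Real.exp (θ * (∑ i, v i * q i) ^ 2 / 2)) * √(2 * Real.pi) ≤
      ∫ x : ℝ, Real.exp (-((1 - θ) / 2) * x ^ 2) := by
    have e1 : signAvg (fun q => Real.exp (θ * (∑ i, v i * q i) ^ 2 / 2)) * √(2 * Real.pi) =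
        ∫ x : ℝ, signAvg fun q => Real.exp ((√θ * ∑ i, v i * q i) * x - x ^ 2 / 2) := by
      simp only [signAvg]
      rw [MeasureTheory.integral_div, MeasureTheory.integral_finsetSum _
        fun q _ => integrable_exp_quadratic _, div_mul_eq_mul_div, Finset.sum_mul]
      congr 1
      refine Finset.sum_congr rfl fun q _ => ?_
      rw [integral_exp_quadratic, mul_pow, hθ]
    rw [e1]
    refine MeasureTheory.integral_mono ?_ (integrable_exp_neg_mul_sq hb) fun x => ?_
    · simp only [signAvg]
      exact (MeasureTheory.integrable_finsetSum _ fun q _ => integrable_exp_quadratic _).div_const _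
    · have e2 : ∀ q : Fin n → ℝ, Real.exp ((√θ * ∑ i, v i * q i) * x - x ^ 2 / 2) =
          Real.exp (-(x ^ 2 / 2)) * Real.exp (∑ i, (√θ * x * v i) * q i) := fun q => by
        rw [← Real.exp_add, Finset.mul_sum, Finset.sum_mul]
        congr 1
        rw [sub_eq_neg_add]
        congr 1
        exact Finset.sum_congr rfl fun i _ => by ring
      simp only [e2]
      rw [signAvg_const_mul]
      refine (mul_le_mul_of_nonneg_left (signAvg_exp_le _) (by positivity)).trans (le_of_eq ?_)
      simp_rw [mul_pow]
      rw [← Finset.mul_sum, hv, hθ, ← Real.exp_add]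
      congr 1; ring
  rw [integral_gaussian, ← le_div_iff₀ hpi] at key
  refine key.trans (le_of_eq ?_)
  rw [div_eq_iff hpi.ne', ← Real.sqrt_inv, ← Real.sqrt_mul (by positivity)]
  congr 1
  have : (1 - θ) ≠ 0 := by linarith
  field_simp

/-- Because `(1 - x + x²/2)(1 + x + x²/2) = 1 + x⁴/4 ≥ 1`. -/
lemma exp_neg_le_quadratic {x : ℝ} (hx : 0 ≤ x) : Real.exp (-x) ≤ 1 - x + x ^ 2 / 2 := by
  have h1 := Real.quadratic_le_exp_of_nonneg hx
  have h2 : Real.exp (-x) * Real.exp x = 1 := by rw [← Real.exp_add]; simp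
  have h3 : 0 ≤ 1 - x + x ^ 2 / 2 := by nlinarith [sq_nonneg (x - 1)]
  have h4 := mul_le_mul_of_nonneg_left h1 h3
  refine le_of_mul_le_mul_right (a := Real.exp x) ?_ (Real.exp_pos _)
  nlinarith [sq_nonneg (x ^ 2)]

lemma signAvg_upper {v : Fin n → ℝ} (hv : ∑ i, v i ^ 2 = 1) :
    signAvg (fun q => Real.exp ((∑ i, v i * q i) ^ 2 / 50)) ≤ Real.exp (21 / 1000) := by
  have h := signAvg_exp_sq_le hv (θ := 1 / 25) (by norm_num) (by norm_num)
  have h1 : (√(1 - 1 / 25))⁻¹ ≤ (1021 / 1000 : ℝ) := by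
    rw [inv_le_comm₀ (by norm_num) (by norm_num)]
    exact Real.le_sqrt_of_sq_le (by norm_num)
  have h2 := Real.add_one_le_exp (21 / 1000)
  have h3 : ∀ t : ℝ, 1 / 25 * t / 2 = t / 50 := fun t => by ring
  simp only [h3] at h
  linarith

/-- The second-order term of `exp (-t/50)` is `t²/5000 = (1/25)(t²/200)`, controlled by `(1/25)(exp
(t/10) - 1 - t/10)`. The exponential moment at `θ = 1/5` and mean 1 give `(1/25)(1.12) - 3/125 +
24/25 < 1 - 19/1000`. -/
lemma signAvg_lower {v : Fin n → ℝ} (hv : ∑ i, v i ^ 2 = 1) :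
    signAvg (fun q => Real.exp (-((∑ i, v i * q i) ^ 2 / 50))) ≤ Real.exp (-(19 / 1000)) := by
  set t : (Fin n → ℝ) → ℝ := fun q => (∑ i, v i * q i) ^ 2
  have ht : ∀ q, 0 ≤ t q := fun q => sq_nonneg _
  have h := signAvg_exp_sq_le hv (θ := 1 / 5) (by norm_num) (by norm_num)
  have h1 : (√(1 - 1 / 5))⁻¹ ≤ (112 / 100 : ℝ) := by
    rw [inv_le_comm₀ (by norm_num) (by norm_num)]
    exact Real.le_sqrt_of_sq_le (by norm_num)
  have h2 : signAvg t = 1 := (signAvg_sq v).trans hv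
  have h3 : signAvg (fun q => Real.exp (-(t q / 50))) ≤
      signAvg fun q => (1 / 25) * Real.exp (1 / 5 * t q / 2) + (-(3 / 125) * t q + 24 / 25) := by
    refine signAvg_mono fun q => ?_
    have e1 := exp_neg_le_quadratic (x := t q / 50) (by linarith [ht q])
    have e2 := Real.quadratic_le_exp_of_nonneg (x := 1 / 5 * t q / 2) (by linarith [ht q])
    nlinarith
  rw [signAvg_add, signAvg_add, signAvg_const_mul, signAvg_const_mul, signAvg_const, h2] at h3
  have h4 := Real.add_one_le_exp (-(19 / 1000) : ℝ)
  change signAvg (fun q => Real.exp (1 / 5 * t q / 2)) ≤ _ at h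
  linarith

end

/-! ### Costs and failure probabilities of programs -/

section
open Matrix

variable {n d : ℕ} {α β : Type}

namespace Prog

lemma bind_eq (P : Prog n d α) (f : α → Prog n d β) : (P >>= f) = P.bind f := rfl

lemma pure_eq (a : α) : (pure a : Prog n d α) = .ret a := rfl

/-! ### Worst-case costs -/

/-- `P` makes at most `S` solver calls and `O` other elementary steps. -/
def Cost (A : Matrix (Fin n) (Fin d) ℝ) : Prog n d α → ℕ → ℕ → Prop
  | .ret _, _, _ => True
  | .arith o x y k, S, O => 1 ≤ O ∧ Cost A (k (o.eval x y)) S (O - 1)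
  | .signs k, S, O => n ≤ O ∧ ∀ q : Fin n → Bool, Cost A (k (signVec q)) S (O - n)
  | .solve D b k, S, O =>
      1 ≤ S ∧ Cost A (k ((Aᵀ * Matrix.diagonal D * A)⁻¹ *ᵥ b)) (S - 1) O

variable {A : Matrix (Fin n) (Fin d) ℝ}

lemma Cost.mono {P : Prog n d α} : ∀ {S O S' O' : ℕ}, P.Cost A S O → S ≤ S' → O ≤ O' →
    P.Cost A S' O' := by
  induction P with
  | ret a => intros; trivial
  | arith o x y k ih =>
    intro S O S' O' h hS hO
    exact ⟨h.1.trans hO, ih _ h.2 hS (by omega)⟩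
  | signs k ih =>
    intro S O S' O' h hS hO
    exact ⟨h.1.trans hO, fun q => ih _ (h.2 q) hS (by omega)⟩
  | solve D b k ih =>
    intro S O S' O' h hS hO
    exact ⟨h.1.trans hS, ih _ h.2 (by omega) hO⟩

lemma Cost.bind {P : Prog n d α} {f : α → Prog n d β} {S' O' : ℕ} : ∀ {S O : ℕ},
    P.Cost A S O → (∀ a, (f a).Cost A S' O') → (P.bind f).Cost A (S + S') (O + O') := by
  induction P with
  | ret a => intro S O _ hf; exact (hf a).mono (by omega) (by omega)
  | arith o x y k ih =>
    intro S O h hf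
    have h1 := h.1
    exact ⟨by omega, (ih _ h.2 hf).mono le_rfl (by omega)⟩
  | signs k ih =>
    intro S O h hf
    have h1 := h.1
    exact ⟨by omega, fun q => (ih _ (h.2 q) hf).mono le_rfl (by omega)⟩
  | solve D b k ih =>
    intro S O h hf
    have h1 := h.1
    exact ⟨by omega, (ih _ h.2 hf).mono (by omega) le_rfl⟩

lemma Cost.of_mem_support {P : Prog n d α} : ∀ {S O : ℕ}, P.Cost A S O →
    ∀ r ∈ (P.run A).support, r.solves ≤ S ∧ r.ops ≤ O := by
  induction P with
  | ret a =>
    intro S O _ r hr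
    simp only [Prog.run, PMF.support_pure, Set.mem_singleton_iff] at hr
    subst hr; simp
  | arith o x y k ih =>
    intro S O h r hr
    simp only [Prog.run, PMF.support_map, Set.mem_image] at hr
    obtain ⟨r', hr', rfl⟩ := hr
    have := ih _ h.2 r' hr'
    have := h.1
    dsimp only; omega
  | signs k ih =>
    intro S O h r hr
    simp only [Prog.run, PMF.mem_support_bind_iff, PMF.support_map, Set.mem_image] at hr
    obtain ⟨q, -, r', hr', rfl⟩ := hr
    have := ih _ (h.2 q) r' hr'
    have := h.1
    dsimp only; omega
  | solve D b k ih =>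
    intro S O h r hr
    simp only [Prog.run, PMF.support_map, Set.mem_image] at hr
    obtain ⟨r', hr', rfl⟩ := hr
    have := ih _ h.2 r' hr'
    have := h.1
    dsimp only; omega

lemma cost_pure (a : α) : (pure a : Prog n d α).Cost A 0 0 := trivial

lemma cost_op (o : Op) (x y : ℝ) : (op o x y : Prog n d ℝ).Cost A 0 1 := ⟨le_rfl, trivial⟩

lemma cost_drawSigns : (drawSigns : Prog n d (Fin n → ℝ)).Cost A 0 n :=
  ⟨le_rfl, fun _ => trivial⟩

lemma cost_callSolver (D : Fin n → ℝ) (b : Fin d → ℝ) :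
    (callSolver D b : Prog n d (Fin d → ℝ)).Cost A 1 0 := ⟨le_rfl, trivial⟩

lemma cost_tabulate : ∀ {m : ℕ} {f : Fin m → Prog n d α} (g : Fin m → ℕ),
    (∀ i, (f i).Cost A 0 (g i)) → (tabulate m f).Cost A 0 (∑ i, g i)
  | 0, _, _, _ => trivial
  | m + 1, f, g, h => by
    rw [Fin.sum_univ_succ]
    exact (h 0).bind (S := 0) (S' := 0) fun a => ((cost_tabulate (fun i => g i.succ)
      fun i => h i.succ).bind (S' := 0) (O' := 0) fun _ => cost_pure _).mono le_rfl le_rfl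

lemma cost_tabulate_const {m c : ℕ} {f : Fin m → Prog n d α} (h : ∀ i, (f i).Cost A 0 c) :
    (tabulate m f).Cost A 0 (m * c) := by
  simpa using cost_tabulate (fun _ => c) h

lemma cost_sumOver {ι : Type} {c : ℕ} {f : ι → Prog n d ℝ} (h : ∀ a, (f a).Cost A 0 c) :
    ∀ l : List ι, (sumOver l f).Cost A 0 (l.length * (c + 1))
  | [] => trivial
  | a :: l => ((h a).bind (S' := 0) fun x => (cost_sumOver h l).bind (S' := 0)
      fun s => cost_op .add x s).mono le_rfl (by rw [List.length_cons]; ring_nf; omega)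

/-! ### Expectations -/

open Classical in
/-- The expectation of `φ` at the value returned by `P`, where a run contributes `1` as soon as it
makes an inadmissible solver call. -/
def expect (A : Matrix (Fin n) (Fin d) ℝ) : Prog n d α → (α → ℝ) → ℝ
  | .ret a, φ => φ a
  | .arith o x y k, φ => expect A (k (o.eval x y)) φ
  | .signs k, φ => signAvg fun q => expect A (k q) φ
  | .solve D b k, φ =>
      if ∀ i, A i ≠ 0 → 0 < D i then expect A (k ((Aᵀ * Matrix.diagonal D * A)⁻¹ *ᵥ b)) φ else 1

lemma expect_bind (P : Prog n d α) (f : α → Prog n d β) (φ : β → ℝ) :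
    (P.bind f).expect A φ = P.expect A fun a => (f a).expect A φ := by
  induction P with
  | ret a => rfl
  | arith o x y k ih => exact ih _
  | signs k ih => simp only [Prog.bind, expect, ih]
  | solve D b k ih => simp only [Prog.bind, expect, ih]

lemma expect_mono (P : Prog n d α) {φ ψ : α → ℝ} (h : ∀ a, φ a ≤ ψ a) :
    P.expect A φ ≤ P.expect A ψ := by
  induction P with
  | ret a => exact h a
  | arith o x y k ih => exact ih _
  | signs k ih => exact signAvg_mono fun q => ih q
  | solve D b k ih =>
    simp only [expect]
    split_ifs
    · exact ih _
    · rfl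

/-- Only an inequality: runs with an inadmissible call contribute exactly 1, without the added
constant. -/
lemma expect_add_const_le (P : Prog n d α) (φ : α → ℝ) {c : ℝ} (hc : 0 ≤ c) :
    P.expect A (fun a => φ a + c) ≤ P.expect A φ + c := by
  induction P with
  | ret a => rfl
  | arith o x y k ih => exact ih _
  | signs k ih =>
    refine (signAvg_mono fun q => ih q).trans (le_of_eq ?_)
    rw [signAvg_add, signAvg_const]
    rfl
  | solve D b k ih =>
    simp only [expect]
    split_ifs
    · exact ih _
    · linarith

lemma expect_le_one (P : Prog n d α) {φ : α → ℝ} (h : ∀ a, φ a ≤ 1) : P.expect A φ ≤ 1 := by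
  induction P with
  | ret a => exact h a
  | arith o x y k ih => exact ih _
  | signs k ih => exact (signAvg_mono fun q => ih q).trans_eq (signAvg_const 1)
  | solve D b k ih =>
    simp only [expect]
    split_ifs
    · exact ih _
    · rfl

lemma expect_nonneg (P : Prog n d α) {φ : α → ℝ} (h : ∀ a, 0 ≤ φ a) : 0 ≤ P.expect A φ := by
  induction P with
  | ret a => exact h a
  | arith o x y k ih => exact ih _
  | signs k ih => exact (signAvg_const 0).symm.trans_le (signAvg_mono fun q => ih q)
  | solve D b k ih =>
    simp only [expect]
    split_ifs
    · exact ih _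
    · norm_num

lemma expect_callSolver {D : Fin n → ℝ} (hD : ∀ i, A i ≠ 0 → 0 < D i) (b : Fin d → ℝ)
    (φ : (Fin d → ℝ) → ℝ) :
    (callSolver D b).expect A φ = φ ((Aᵀ * Matrix.diagonal D * A)⁻¹ *ᵥ b) :=
  if_pos hD

open Classical in
/-- The probability that a run makes an inadmissible solver call or returns a value violating `Q`. -/
def failure (A : Matrix (Fin n) (Fin d) ℝ) (P : Prog n d α) (Q : α → Prop) : ℝ :=
  P.expect A fun a => if Q a then 0 else 1

lemma failure_le_one (P : Prog n d α) (Q : α → Prop) : P.failure A Q ≤ 1 :=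
  expect_le_one P fun a => by split_ifs <;> norm_num

lemma failure_nonneg (P : Prog n d α) (Q : α → Prop) : 0 ≤ P.failure A Q :=
  expect_nonneg P fun a => by split_ifs <;> norm_num

/-- The union bound for sequential composition. -/
lemma failure_bind_le {P : Prog n d α} {f : α → Prog n d β} {Q : α → Prop} {R : β → Prop}
    {δ : ℝ} (hδ : 0 ≤ δ) (h : ∀ a, Q a → (f a).failure A R ≤ δ) :
    (P.bind f).failure A R ≤ P.failure A Q + δ := by
  rw [failure, expect_bind]
  refine (expect_mono P fun a => ?_).trans (expect_add_const_le P _ hδ)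
  split_ifs with hQ
  · rw [zero_add]; exact h a hQ
  · exact (failure_le_one _ _).trans (by linarith)

/-- Transfers bounds for the recursively defined `failure` to the actual law of the run. -/
lemma toOuterMeasure_failure_le (P : Prog n d α) (Q : α → Prop) :
    (P.run A).toOuterMeasure {r | ¬(r.legal ∧ Q r.val)} ≤ ENNReal.ofReal (P.failure A Q) := by
  have le_one : ∀ {γ : Type} (μ : PMF γ) (s : Set γ), μ.toOuterMeasure s ≤ 1 := fun μ s => by
    rw [← μ.toOuterMeasure_apply_eq_one_iff (Set.univ) |>.2 (Set.subset_univ _)]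
    exact μ.toOuterMeasure.mono (Set.subset_univ _)
  induction P with
  | ret a =>
    rw [Prog.run, failure, expect]
    by_cases h : Q a
    · simp [PMF.toOuterMeasure_pure_apply, h]
    · simp [PMF.toOuterMeasure_pure_apply, h]
  | arith o x y k ih =>
    rw [Prog.run, PMF.toOuterMeasure_map_apply]
    exact ih _
  | signs k ih =>
    rw [Prog.run, PMF.toOuterMeasure_bind_apply, tsum_fintype]
    simp only [PMF.toOuterMeasure_map_apply, PMF.uniformOfFintype_apply]
    rw [← Finset.mul_sum]
    have h1 : failure A (.signs k) Q =
        (2 ^ n)⁻¹ * ∑ q : Fin n → Bool, failure A (k (signVec q)) Q :=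
      div_eq_inv_mul _ _
    rw [h1, ENNReal.ofReal_mul (by positivity), ENNReal.ofReal_sum_of_nonneg
      fun q _ => failure_nonneg _ _]
    refine mul_le_mul' (le_of_eq ?_) (Finset.sum_le_sum fun q _ => ih _)
    rw [ENNReal.ofReal_inv_of_pos (by positivity), ENNReal.ofReal_pow (by norm_num)]
    simp
  | solve D b k ih =>
    rw [Prog.run, PMF.toOuterMeasure_map_apply]
    by_cases hD : ∀ i, A i ≠ 0 → 0 < D i
    · have h1 : failure A (.solve D b k) Q =
          failure A (k ((Aᵀ * Matrix.diagonal D * A)⁻¹ *ᵥ b)) Q := if_pos hD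
      rw [h1]
      refine le_trans (le_of_eq ?_) (ih _)
      congr 1
      ext r
      simp only [Set.mem_preimage, Set.mem_ofPred_eq]
      tauto
    · have h1 : failure A (.solve D b k) Q = 1 := if_neg hD
      rw [h1, ENNReal.ofReal_one]
      exact le_one _ _

lemma le_toOuterMeasure_success (P : Prog n d α) (Q : α → Prop) {δ : ℝ}
    (h : P.failure A Q ≤ δ) :
    ENNReal.ofReal (1 - δ) ≤ (P.run A).toOuterMeasure {r | r.legal ∧ Q r.val} := by
  have h1 : (P.run A).toOuterMeasure Set.univ = 1 :=
    ((P.run A).toOuterMeasure_apply_eq_one_iff _).2 (Set.subset_univ _)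
  have h2 := MeasureTheory.measure_union_le (μ := (P.run A).toOuterMeasure)
    {r | r.legal ∧ Q r.val} {r | ¬(r.legal ∧ Q r.val)}
  have h3 : {r : Outcome α | r.legal ∧ Q r.val} ∪ {r | ¬(r.legal ∧ Q r.val)} = Set.univ := by
    ext r; simp [em]
  rw [h3, h1] at h2
  have h4 := (toOuterMeasure_failure_le (A := A) P Q).trans (ENNReal.ofReal_le_ofReal h)
  rw [ENNReal.ofReal_sub _ ((failure_nonneg _ _).trans h), ENNReal.ofReal_one, tsub_le_iff_right]
  exact h2.trans (add_le_add_right h4 _)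

/-! ### Deterministic programs -/

/-- `P` always returns `a`, without calling the solver. -/
def Computes (A : Matrix (Fin n) (Fin d) ℝ) (P : Prog n d α) (a : α) : Prop :=
  ∀ φ : α → ℝ, P.expect A φ = φ a

lemma computes_op (o : Op) (x y : ℝ) : (op o x y : Prog n d ℝ).Computes A (o.eval x y) :=
  fun _ => rfl

lemma Computes.bind {P : Prog n d α} {f : α → Prog n d β} {a : α} {b : β}
    (hP : P.Computes A a) (hf : (f a).Computes A b) : (P.bind f).Computes A b := fun φ => by
  rw [expect_bind, hP, hf]

lemma computes_tabulate : ∀ {m : ℕ} {f : Fin m → Prog n d α} {v : Fin m → α},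
    (∀ i, (f i).Computes A (v i)) → (tabulate m f).Computes A v
  | 0, _, _, _ => fun φ => congrArg φ (Subsingleton.elim _ _)
  | _ + 1, _, v, h => (h 0).bind ((computes_tabulate fun i => h i.succ).bind
      fun φ => congrArg φ (Fin.cons_self_tail v))

lemma computes_sumOver {ι : Type} {f : ι → Prog n d ℝ} {v : ι → ℝ}
    (h : ∀ a, (f a).Computes A (v a)) :
    ∀ l : List ι, (sumOver l f).Computes A (l.map v).sum
  | [] => fun _ => rfl
  | a :: l => by
    rw [List.map_cons, List.sum_cons]
    exact (h a).bind ((computes_sumOver h l).bind (computes_op .add _ _))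

end Prog

/-! ### Sparse products and the cost of the algorithm -/

lemma list_sum_filter {ι : Type*} (l : List ι) (p : ι → Bool) (g : ι → ℝ)
    (h : ∀ a, p a = false → g a = 0) : ((l.filter p).map g).sum = (l.map g).sum := by
  induction l with
  | nil => rfl
  | cons a l ih =>
    cases hp : p a
    · rw [List.filter_cons_of_neg (by simp [hp])]; simp [ih, h a hp]
    · rw [List.filter_cons_of_pos hp]; simp [ih]

variable (A : Matrix (Fin n) (Fin d) ℝ)

open Prog

lemma computes_mulA (x : Fin d → ℝ) : (mulA A x).Computes A (A *ᵥ x) := by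
  classical
  refine computes_tabulate fun i => ?_
  have := computes_sumOver (A := A) (fun j => computes_op (A := A) .mul (A i j) (x j))
    ((List.finRange d).filter fun j => A i j ≠ 0)
  rw [list_sum_filter _ _ _ fun j hj => by
    have : A i j = 0 := by simpa using hj
    simp [Op.eval, this], ← Fin.sum_univ_def] at this
  convert this using 1
  rfl

lemma computes_mulAT (u : Fin n → ℝ) : (mulAT A u).Computes A (Aᵀ *ᵥ u) := by
  classical
  refine computes_tabulate fun j => ?_
  have := computes_sumOver (A := A) (fun i => computes_op (A := A) .mul (A i j) (u i))
    ((List.finRange n).filter fun i => A i j ≠ 0)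
  rw [list_sum_filter _ _ _ fun i hi => by
    have : A i j = 0 := by simpa using hi
    simp [Op.eval, this], ← Fin.sum_univ_def] at this
  convert this using 1
  rfl

open Classical in
lemma sum_card_row : ∑ i, (Finset.univ.filter fun j => A i j ≠ 0).card = nnz A := by
  rw [nnz, Set.ncard_eq_toFinset_card', Set.toFinset_ofPred]
  simp_rw [Finset.card_filter]
  rw [← Finset.univ_product_univ, Finset.sum_product]

open Classical in
lemma sum_card_col : ∑ j, (Finset.univ.filter fun i => A i j ≠ 0).card = nnz A := by
  rw [← sum_card_row]
  simp_rw [Finset.card_filter]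
  exact Finset.sum_comm

lemma length_filter_finRange {m : ℕ} (p : Fin m → Prop) [DecidablePred p] :
    ((List.finRange m).filter fun i => p i).length = (Finset.univ.filter p).card := rfl

lemma cost_mulA (x : Fin d → ℝ) : (mulA A x).Cost A 0 (2 * nnz A) := by
  classical
  rw [← sum_card_row, Finset.mul_sum]
  refine cost_tabulate _ fun i => (cost_sumOver (c := 1) (fun j => cost_op _ _ _) _).mono le_rfl ?_
  rw [mul_comm]
  exact le_of_eq (congrArg _ (by convert length_filter_finRange _))

lemma cost_mulAT (u : Fin n → ℝ) : (mulAT A u).Cost A 0 (2 * nnz A) := by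
  classical
  rw [← sum_card_col, Finset.mul_sum]
  refine cost_tabulate _ fun i => (cost_sumOver (c := 1) (fun j => cost_op _ _ _) _).mono le_rfl ?_
  rw [mul_comm]
  exact le_of_eq (congrArg _ (by convert length_filter_finRange _))

lemma cost_sketchSum (s D : Fin n → ℝ) : ∀ k,
    (sketchSum A s D k).Cost A k (k * (5 * n + 4 * nnz A))
  | 0 => trivial
  | k + 1 => by
    refine ((cost_sketchSum s D k).bind fun acc => cost_drawSigns.bind fun q =>
      (cost_tabulate_const fun i => cost_op _ _ _).bind fun u => (cost_mulAT A u).bind fun b =>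
      (cost_callSolver D b).bind fun x => (cost_mulA A x).bind fun y =>
      cost_tabulate_const (c := 3) fun i => (cost_op _ _ _).bind fun z => (cost_op _ _ _).bind
        fun z2 => cost_op _ _ _).mono (by omega) (le_of_eq (by ring))

lemma cost_approxLev (c ε : ℝ) (s : Fin n → ℝ) : (approxLev A c ε s).Cost A (sketchSize n c ε)
    (2 * n + sketchSize n c ε * (5 * n + 4 * nnz A)) :=
  ((cost_tabulate_const fun i => cost_op _ _ _).bind fun D => (cost_sketchSum A s D _).bind
    fun acc => cost_tabulate_const fun i => cost_op _ _ _).mono (by omega) (le_of_eq (by ring))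

lemma cost_lewisIterate (c e : ℝ) (w₀ : Fin n → ℝ) : ∀ k,
    (lewisIterate A c e w₀ k).Cost A (k * sketchSize n c (1 / 10))
      (k * (4 * n + sketchSize n c (1 / 10) * (5 * n + 4 * nnz A)))
  | 0 => trivial
  | k + 1 => ((cost_lewisIterate c e w₀ k).bind fun a =>
      (cost_tabulate_const fun i => cost_op _ _ _).bind fun s => (cost_approxLev A c _ s).bind
      fun w' => (cost_tabulate_const fun i => cost_op _ _ _).bind (S' := 0) (O' := 0)
      fun t => cost_pure _).mono (le_of_eq (by ring)) (le_of_eq (by ring))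

lemma cost_approxLargeWeights (c p : ℝ) : (approxLargeWeights A c p).Cost A
    (numIter n * sketchSize n c (1 / 10))
    (5 + n + numIter n * (4 * n + sketchSize n c (1 / 10) * (5 * n + 4 * nnz A))) :=
  ((cost_op _ _ _).bind fun pinv => (cost_op _ _ _).bind fun e => (cost_op _ _ _).bind fun a =>
    (cost_lewisIterate A c e (fun _ => a) _).bind fun r => (cost_op _ _ _).bind fun t2 =>
    (cost_op _ _ _).bind fun f => cost_tabulate_const fun i => cost_op _ _ _).mono
    (by omega) (le_of_eq (by ring))

/-- The `+ 1` from each ceiling is absorbed by `1 + log n`. At accuracy 1/10 the factor `ε⁻²` is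
100, whence `5000 c = 5 * 10 * 100 c`. -/
lemma cost_bound {c : ℝ} (hc : 0 < c) (hn : 0 < n) (p : ℝ) :
    ∀ r ∈ ((approxLargeWeights A c p).run A).support,
      (r.solves : ℝ) ≤ (100 + 5000 * c) * (1 + Real.log n) ^ 2 ∧
      (r.ops : ℝ) ≤ (100 + 5000 * c) * (1 + Real.log n) ^ 2 * (nnz A + n : ℝ) := by
  intro r hr
  obtain ⟨h1, h2⟩ := (cost_approxLargeWeights A c p).of_mem_support r hr
  have hL : 0 ≤ Real.log n := Real.log_natCast_nonneg n
  set L := 1 + Real.log n with hLdef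
  have hL1 : 1 ≤ L := by linarith
  have hT : (numIter n : ℝ) ≤ 10 * L := by
    have := Nat.ceil_lt_add_one (a := 10 * Real.log n) (by positivity)
    rw [numIter]; linarith
  have hk : (sketchSize n c (1 / 10) : ℝ) ≤ (100 * c + 1) * L := by
    have := Nat.ceil_lt_add_one (a := c / (1 / 10) ^ 2 * Real.log n) (by positivity)
    have h3 : c / (1 / 10) ^ 2 = 100 * c := by ring
    rw [sketchSize]
    rw [h3] at this ⊢
    nlinarith
  have hN : (1 : ℝ) ≤ nnz A + n := by
    have : (1 : ℝ) ≤ n := by exact_mod_cast hn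
    have : (0 : ℝ) ≤ nnz A := by positivity
    linarith
  have hTk : (numIter n : ℝ) * sketchSize n c (1 / 10) ≤ 10 * (100 * c + 1) * L ^ 2 := by
    calc _ ≤ 10 * L * ((100 * c + 1) * L) := mul_le_mul hT hk (by positivity) (by positivity)
      _ = _ := by ring
  have hL2 : L ≤ L ^ 2 := by nlinarith
  constructor
  · have h1' : (r.solves : ℝ) ≤ numIter n * sketchSize n c (1 / 10) := by exact_mod_cast h1
    refine h1'.trans (hTk.trans ?_)
    gcongr
    linarith
  · have h2' : (r.ops : ℝ) ≤ 5 + n + numIter n *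
        (4 * n + sketchSize n c (1 / 10) * (5 * n + 4 * nnz A)) := by exact_mod_cast h2
    set N : ℝ := nnz A + n
    have hz : (0 : ℝ) ≤ nnz A := by positivity
    have hn0 : (0 : ℝ) ≤ n := by positivity
    have h3 : (5 * n + 4 * nnz A : ℝ) ≤ 5 * N := by simp only [N]; linarith
    have h4 : (n : ℝ) ≤ N := by simp only [N]; linarith
    calc (r.ops : ℝ) ≤ _ := h2'
      _ ≤ 5 * N + N + numIter n * (4 * N + sketchSize n c (1 / 10) * (5 * N)) := by
        gcongr; linarith
      _ = 6 * N + 4 * numIter n * N + 5 * (numIter n * sketchSize n c (1 / 10)) * N := by ring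
      _ ≤ 6 * L ^ 2 * N + 4 * (10 * L ^ 2) * N + 5 * (10 * (100 * c + 1) * L ^ 2) * N := by
        gcongr
        · nlinarith
        · linarith
      _ = (96 + 5000 * c) * L ^ 2 * N := by ring
      _ ≤ _ := by gcongr; linarith

end

/-! ### Success probability of the algorithm -/

section
open Matrix Prog

variable {n d : ℕ} {A : Matrix (Fin n) (Fin d) ℝ}

/-- A potential that does not increase on average under one sketch has final expectation at most its
initial value. Nonvanishing of `s` on nonzero rows makes each call admissible. -/
lemma expect_sketchSum_le {s : Fin n → ℝ} (hs : ∀ i, A i ≠ 0 → s i ≠ 0)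
    (Ψ : ℕ → (Fin n → ℝ) → ℝ)
    (hΨ : ∀ m acc, signAvg (fun q => Ψ (m + 1) fun i =>
      acc i + (proj (diagonal s * A) *ᵥ q) i ^ 2) ≤ Ψ m acc) :
    ∀ k, (sketchSum A s (fun i => s i * s i) k).expect A (Ψ k) ≤ Ψ 0 fun _ => 0
  | 0 => le_rfl
  | k + 1 => by
    rw [sketchSum, bind_eq, expect_bind]
    refine (expect_mono _ fun acc => ?_).trans (expect_sketchSum_le hs Ψ hΨ k)
    refine le_trans (le_of_eq ?_) (hΨ k acc)
    rw [bind_eq, expect_bind]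
    change signAvg _ = _
    congr 1
    ext q
    change Prog.expect A (Prog.bind _ _) _ = _
    rw [expect_bind, computes_tabulate fun i => computes_op .mul (s i) (q i), bind_eq, expect_bind,
      computes_mulAT, bind_eq, expect_bind,
      expect_callSolver fun i hi => mul_self_pos.2 (hs i hi), bind_eq, expect_bind, computes_mulA]
    refine (computes_tabulate (v := fun i => acc i + (proj (diagonal s * A) *ᵥ q) i ^ 2)
      fun i => ?_) _
    rw [proj_mulVec, sq]
    exact (computes_op _ _ _).bind ((computes_op _ _ _).bind (computes_op _ _ _))

/-- The exponential potential of one row after `m` out of `k` sketches, where `σ` is the leverage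
score and `t` the current sum of squares. -/
def rowPotential (k : ℕ) (σ : ℝ) (m : ℕ) (t : ℝ) : ℝ :=
  if σ = 0 then (if t = 0 then 0 else 1) else
    Real.exp ((m - k : ℝ) / 1000) *
      (Real.exp (t / (50 * σ) - 11 / 500 * m) + Real.exp (9 / 500 * m - t / (50 * σ)))

lemma rowPotential_nonneg (k : ℕ) (σ : ℝ) (m : ℕ) (t : ℝ) : 0 ≤ rowPotential k σ m t := by
  rw [rowPotential]
  split_ifs <;> positivity

lemma rowPotential_zero_le (k : ℕ) (σ : ℝ) :
    rowPotential k σ 0 0 ≤ 2 * Real.exp (-(k / 1000)) := by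
  rw [rowPotential]
  split_ifs with h h0
  · positivity
  · exact absurd rfl h0
  · simp only [Nat.cast_zero, zero_div, mul_zero, sub_zero, Real.exp_zero, zero_sub, neg_div]
    linarith

/-- The exponents `11/500` and `9/500` are the thresholds `11/10` and `9/10` divided by 50, so a
violated bound makes one exponent nonnegative. -/
lemma one_le_rowPotential {k : ℕ} (hk : 0 < k) {σ t : ℝ} (hσ : 0 ≤ σ)
    (h : ¬(9 / 10 * σ ≤ t / k ∧ t / k ≤ 11 / 10 * σ)) : 1 ≤ rowPotential k σ k t := by
  have hkR : (0 : ℝ) < k := by exact_mod_cast hk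
  rw [rowPotential]
  split_ifs with h1 h2
  · exact absurd (by simp [h1, h2]) h
  · rfl
  · have hσ' : 0 < σ := hσ.lt_of_ne' h1
    simp only [sub_self, zero_div, Real.exp_zero, one_mul]
    rw [not_and_or, not_le, not_le] at h
    rcases h with h | h
    · have : 0 ≤ 9 / 500 * (k : ℝ) - t / (50 * σ) := by
        rw [div_lt_iff₀ hkR] at h
        rw [sub_nonneg, div_le_iff₀ (by positivity)]
        linarith
      have := Real.one_le_exp this
      have := Real.exp_pos (t / (50 * σ) - 11 / 500 * k)
      linarith
    · have : 0 ≤ t / (50 * σ) - 11 / 500 * (k : ℝ) := by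
        rw [lt_div_iff₀ hkR] at h
        rw [sub_nonneg, le_div_iff₀ (by positivity)]
        linarith
      have := Real.one_le_exp this
      have := Real.exp_pos (9 / 500 * k - t / (50 * σ))
      linarith

/-- Chernoff step: a sketch multiplies the two exponential moments by at most `exp (21/1000)` and
`exp (-19/1000)`. The thresholds `22/1000` and `18/1000` leave a gain of `exp (-1/1000)` on either
side, exactly offset by the prefactor. If `σ = 0`, the row of the projection vanishes and the sum
does not change. -/
lemma signAvg_rowPotential_le (v : Fin n → ℝ) (k m : ℕ) (t : ℝ) :
    signAvg (fun q => rowPotential k (∑ j, v j ^ 2) (m + 1) (t + (v ⬝ᵥ q) ^ 2)) ≤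
      rowPotential k (∑ j, v j ^ 2) m t := by
  set σ := ∑ j, v j ^ 2 with hσ
  have hσ0 : 0 ≤ σ := by positivity
  rcases hσ0.eq_or_lt with h0 | hpos
  · have hv : v = 0 := by
      ext j
      have := (Finset.sum_eq_zero_iff_of_nonneg fun j _ => sq_nonneg (v j)).1 h0.symm j
        (Finset.mem_univ j)
      simpa using this
    simp only [hv, zero_dotProduct, rowPotential, ← h0, if_true]
    simp [signAvg_const]
  · have hu : ∑ j, (v j / √σ) ^ 2 = 1 := by
      simp_rw [div_pow, Real.sq_sqrt hσ0]
      rw [← Finset.sum_div, div_self hpos.ne']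
    have hq : ∀ q : Fin n → ℝ, (∑ j, v j / √σ * q j) ^ 2 / 50 = (v ⬝ᵥ q) ^ 2 / (50 * σ) := fun q => by
      have : ∑ j, v j / √σ * q j = (v ⬝ᵥ q) / √σ := by
        rw [dotProduct, Finset.sum_div]
        exact Finset.sum_congr rfl fun j _ => by ring
      rw [this, div_pow, Real.sq_sqrt hσ0, div_div, mul_comm σ]
    have hup := signAvg_upper hu
    have hlo := signAvg_lower hu
    simp only [hq] at hup hlo
    simp only [rowPotential, if_neg hpos.ne']
    set E := Real.exp (((m : ℝ) - k) / 1000)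
    set a := Real.exp (t / (50 * σ) - 11 / 500 * m) with ha
    set b := Real.exp (9 / 500 * m - t / (50 * σ)) with hb
    have e1 : ∀ q : Fin n → ℝ, Real.exp ((((m + 1 : ℕ) : ℝ) - k) / 1000) *
        (Real.exp ((t + (v ⬝ᵥ q) ^ 2) / (50 * σ) - 11 / 500 * ((m + 1 : ℕ) : ℝ)) +
          Real.exp (9 / 500 * ((m + 1 : ℕ) : ℝ) - (t + (v ⬝ᵥ q) ^ 2) / (50 * σ))) =
        (E * a * Real.exp (-(21 / 1000))) * Real.exp ((v ⬝ᵥ q) ^ 2 / (50 * σ)) +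
        (E * b * Real.exp (19 / 1000)) * Real.exp (-((v ⬝ᵥ q) ^ 2 / (50 * σ))) := fun q => by
      rw [mul_add]
      simp only [E, ha, hb, ← Real.exp_add]
      push_cast
      congr 2 <;> ring
    simp only [e1]
    rw [signAvg_add, signAvg_const_mul, signAvg_const_mul, mul_add]
    have hE : 0 < E := Real.exp_pos _
    have ha0 : 0 < a := Real.exp_pos _
    have hb0 : 0 < b := Real.exp_pos _
    refine add_le_add ?_ ?_
    · refine (mul_le_mul_of_nonneg_left hup (by positivity)).trans (le_of_eq ?_)
      rw [mul_assoc, ← Real.exp_add (-(21 / 1000)), neg_add_cancel, Real.exp_zero, mul_one]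
    · refine (mul_le_mul_of_nonneg_left hlo (by positivity)).trans (le_of_eq ?_)
      rw [mul_assoc, ← Real.exp_add (19 / 1000), add_neg_cancel, Real.exp_zero, mul_one]

/-- The sketched leverage scores are accurate up to a factor `1 ± 1/10`, except with exponentially
small probability. -/
lemma failure_approxLev_le (hA : A.rank = d) {c : ℝ} (hk : 0 < sketchSize n c (1 / 10))
    {s : Fin n → ℝ} (hs : ∀ i, A i ≠ 0 → s i ≠ 0) :
    (approxLev A c (1 / 10) s).failure A (fun v => ∀ i,
        9 / 10 * leverageScore (diagonal s * A) i ≤ v i ∧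
          v i ≤ 11 / 10 * leverageScore (diagonal s * A) i) ≤
      2 * n * Real.exp (-(sketchSize n c (1 / 10) / 1000)) := by
  have hM := isUnit_of_rank hA hs
  set k := sketchSize n c (1 / 10)
  set σ := leverageScore (diagonal s * A) with hσ
  rw [Prog.failure, approxLev, bind_eq, expect_bind,
    computes_tabulate fun i => computes_op .mul (s i) (s i), bind_eq, expect_bind]
  -- Summing the potentials over the rows builds in the union bound.
  have h1 := expect_sketchSum_le hs (fun m acc => ∑ i, rowPotential k (σ i) m (acc i))
    (fun m acc => by
      rw [signAvg_sum]
      refine Finset.sum_le_sum fun i _ => ?_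
      rw [hσ, ← sum_sq_proj hM]
      exact signAvg_rowPotential_le (proj (diagonal s * A) i) k m (acc i)) k
  refine le_trans (expect_mono _ fun acc => ?_) (h1.trans ?_)
  · rw [computes_tabulate fun i => computes_op .div (acc i) k]
    split_ifs with h
    · exact Finset.sum_nonneg fun i _ => rowPotential_nonneg _ _ _ _
    · push Not at h
      obtain ⟨i, hi⟩ := h
      refine (one_le_rowPotential hk (leverageScore_nonneg hM i) (t := acc i) ?_).trans
        (Finset.single_le_sum (f := fun i => rowPotential k (σ i) k (acc i))
          (fun i _ => rowPotential_nonneg _ _ _ _) (Finset.mem_univ i))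
      rintro ⟨h2, h3⟩
      exact absurd h3 (not_le.2 (hi h2))
  · refine (Finset.sum_le_sum fun i _ => rowPotential_zero_le k (σ i)).trans (le_of_eq ?_)
    simp only [Finset.sum_const, Finset.card_univ, Fintype.card_fin, nsmul_eq_mul]
    ring

/-- `r` consists of the last iterate and the sum of the iterates in a run of `m` accurate steps. -/
def IsIterate (A : Matrix (Fin n) (Fin d) ℝ) (p a : ℝ) (m : ℕ)
    (r : (Fin n → ℝ) × (Fin n → ℝ)) : Prop :=
  ∃ w : ℕ → Fin n → ℝ, (w 0 = fun _ => a) ∧ w m = r.1 ∧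
    (∀ i, r.2 i = ∑ k ∈ Finset.range m, w (k + 1) i) ∧
    ∀ k < m, ApproxScores A p (w k) (w (k + 1))

lemma failure_lewisIterate_le (hA : A.rank = d) {c : ℝ} (hk : 0 < sketchSize n c (1 / 10))
    (p : ℝ) {a : ℝ} (ha : ∀ i, A i ≠ 0 → 0 < a) : ∀ m,
    (lewisIterate A c (1 / 2 - 1 / p) (fun _ => a) m).failure A (IsIterate A p a m) ≤
      m * (2 * n * Real.exp (-(sketchSize n c (1 / 10) / 1000)))
  | 0 => by
    have : IsIterate A p a 0 (fun _ => a, fun _ => 0) :=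
      ⟨fun _ _ => a, rfl, rfl, by simp, by simp⟩
    rw [Prog.failure, lewisIterate, pure_eq, expect]
    simp [this]
  | m + 1 => by
    rw [lewisIterate, bind_eq]
    refine (failure_bind_le (δ := 2 * n * Real.exp (-(sketchSize n c (1 / 10) / 1000)))
      (by positivity) ?_).trans ((add_le_add_left
      (failure_lewisIterate_le hA hk p ha m) _).trans (le_of_eq (by push_cast; ring)))
    rintro ⟨w', total⟩ ⟨w, hw0, hwm, hsum, hw⟩
    -- Accuracy of the earlier steps keeps the weights positive at nonzero rows, so the next solver
    -- calls are admissible.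
    have hpos : ∀ i, A i ≠ 0 → 0 < w' i := by
      rw [← show w m = w' from hwm]
      exact iterates_pos hA (by simpa [hw0] using ha) hw m le_rfl
    refine le_trans ?_ (failure_approxLev_le hA hk (rpow_half_sub_ne_zero hpos (1 / 2 - 1 / p)))
    change Prog.expect A (Prog.bind _ _) _ ≤ _
    rw [expect_bind, computes_tabulate fun i => computes_op .pow (w' i) (1 / 2 - 1 / p), bind_eq,
      expect_bind, Prog.failure]
    refine expect_mono _ fun v => ?_
    rw [bind_eq, expect_bind, computes_tabulate fun i => computes_op .add (total i) (v i),
      pure_eq, expect]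
    by_cases hv : ApproxScores A p w' v
    · rw [if_pos, if_pos]
      · exact hv
      -- The program forgets earlier iterates, so the witness is the old history extended by the new
      -- vector.
      · refine ⟨fun k => if k ≤ m then w k else v, by simp [hw0], by simp, fun i => ?_,
          fun k hk => ?_⟩
        · rw [Finset.sum_range_succ]
          simp only [Op.eval, show ¬ m + 1 ≤ m by omega, if_false]
          congr 1
          refine (hsum i).trans (Finset.sum_congr rfl fun k hk => ?_)
          rw [if_pos (by have := Finset.mem_range.1 hk; omega)]
        · rcases Nat.lt_succ_iff_lt_or_eq.1 hk with h | rfl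
          · simpa [h.le, Nat.succ_le_of_lt h] using hw k h
          · have : w k = w' := hwm
            simpa [this] using hv
    · refine le_trans ?_ (if_neg hv).ge
      split_ifs <;> norm_num

/-- The deterministic wrapper of the iteration in `ApproxLargeWeights`. -/
lemma failure_approxLargeWeights_le (hA : A.rank = d) {p : ℝ} (hp : 2 ≤ p) {c : ℝ}
    (hk : 0 < sketchSize n c (1 / 10)) (hT : 3 ≤ numIter n) (hn : 0 < n) :
    (approxLargeWeights A c p).failure A (IsLewisOverestimate A p) ≤
      numIter n * (2 * n * Real.exp (-(sketchSize n c (1 / 10) / 1000))) := by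
  have hnR : (0 : ℝ) < n := by exact_mod_cast hn
  -- A nonzero row forces `d > 0`; for `d = 0` the starting weight is 0 and there is nothing to
  -- check.
  have ha : ∀ i, A i ≠ 0 → 0 < (d : ℝ) / n := fun i hi => by
    have : 0 < d := Nat.pos_of_ne_zero fun h => hi (by subst h; exact Subsingleton.elim _ _)
    positivity
  change Prog.failure A ((lewisIterate A c (1 / 2 - 1 / p) (fun _ => (d : ℝ) / n) (numIter n)).bind
    fun r => (Prog.op .mul 2 (numIter n : ℝ)).bind fun t2 => (Prog.op .div 3 t2).bind fun f =>
      Prog.tabulate n fun i => Prog.op .mul f (r.2 i)) _ ≤ _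
  refine (failure_bind_le le_rfl ?_).trans
    ((add_zero _).trans_le (failure_lewisIterate_le hA hk p ha (numIter n)))
  rintro ⟨w', total⟩ ⟨w, hw0, -, hsum, hw⟩
  rw [Prog.failure]
  rw [(computes_op (A := A) .mul 2 (numIter n : ℝ)).bind ((computes_op .div 3 _).bind
    (computes_tabulate fun i => computes_op .mul _ (total i))), if_pos]
  have := isLewisOverestimate_of_iterates hA hp hT (Nat.le_ceil _) hw0 ha (by positivity) hw
  convert this using 2 with i
  exact congrArg (3 / (2 * (numIter n : ℝ)) * ·) (hsum i)

/-- This choice of `c` gives `k ≥ 1000 (C + 7) log n`. Seven spare powers of `n` absorb the factor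
`T * 2n ≤ 20 n²`, as `20 ≤ 2⁵ ≤ n⁵`. -/
lemma numIter_mul_failure_le {C : ℝ} (hn : 2 ≤ n) :
    numIter n * (2 * n * Real.exp (-(sketchSize n (10 * (C + 7)) (1 / 10) / 1000))) ≤
      (n : ℝ) ^ (-C) := by
  have hnR : (2 : ℝ) ≤ n := by exact_mod_cast hn
  have hn0 : (0 : ℝ) < n := by linarith
  have hL : 0 ≤ Real.log n := Real.log_natCast_nonneg n
  have hT : (numIter n : ℝ) ≤ 10 * n := by
    have h1 := Nat.ceil_lt_add_one (a := 10 * Real.log n) (by positivity)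
    have h2 := Real.log_le_sub_one_of_pos hn0
    rw [numIter]; linarith
  have hk : Real.exp (-(sketchSize n (10 * (C + 7)) (1 / 10) / 1000)) ≤ (n : ℝ) ^ (-(C + 7)) := by
    rw [Real.rpow_def_of_pos hn0, Real.exp_le_exp]
    have := Nat.le_ceil (10 * (C + 7) / (1 / 10) ^ 2 * Real.log n)
    rw [sketchSize]
    rw [show 10 * (C + 7) / (1 / 10) ^ 2 = 1000 * (C + 7) by ring] at this ⊢
    linarith
  have h5 : (20 : ℝ) ≤ (n : ℝ) ^ 5 := by
    calc (20 : ℝ) ≤ 2 ^ 5 := by norm_num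
      _ ≤ _ := by gcongr
  calc _ ≤ 10 * n * (2 * n * (n : ℝ) ^ (-(C + 7))) := by gcongr
    _ = 20 * n ^ 2 * (n : ℝ) ^ (-(C + 7)) := by ring
    _ ≤ n ^ 5 * n ^ 2 * (n : ℝ) ^ (-(C + 7)) := by gcongr
    _ = (n : ℝ) ^ (-C) := by
      rw [← pow_add, ← Real.rpow_natCast, ← Real.rpow_add hn0]
      congr 1; push_cast; ring

end

end Lewis

end

theorem mainTheorem8 (C : ℝ) (hC : 0 < C) :
    ∃ c K : ℝ, 0 < c ∧ 0 < K ∧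
      ∀ (n d : ℕ) (A : Matrix (Fin n) (Fin d) ℝ) (p : ℝ), 0 < n → A.rank = d → 2 ≤ p →
        (∀ r ∈ ((Lewis.approxLargeWeights A c p).run A).support,
          (r.solves : ℝ) ≤ K * (1 + Real.log n) ^ 2 ∧
          (r.ops : ℝ) ≤ K * (1 + Real.log n) ^ 2 * (Lewis.nnz A + n : ℝ)) ∧
        ENNReal.ofReal (1 - (n : ℝ) ^ (-C)) ≤
          ((Lewis.approxLargeWeights A c p).run A).toOuterMeasure
            {r | r.legal ∧ Lewis.IsLewisOverestimate A p r.val} := by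
  have hc : 0 < 10 * (C + 7) := by linarith
  refine ⟨10 * (C + 7), 100 + 5000 * (10 * (C + 7)), hc, by linarith, fun n d A p hn hA hp =>
    ⟨Lewis.cost_bound A hc hn p, ?_⟩⟩
  -- For `n ≥ 2`, `10 log 2 > 2` yields the required `T ≥ 3`. For `n = 1` no iteration is run, but
  -- `1 - n^(-C) = 0` and the probability bound is void.
  rcases Nat.lt_or_ge 1 n with h | h
  · have hlog : Real.log 2 ≤ Real.log n := Real.log_le_log (by norm_num) (by exact_mod_cast h)
    have hlog2 := Real.log_two_gt_d9
    refine Lewis.Prog.le_toOuterMeasure_success _ _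
      ((Lewis.failure_approxLargeWeights_le hA hp ?_ ?_ hn).trans
        (Lewis.numIter_mul_failure_le h))
    · rw [Lewis.sketchSize, Nat.ceil_pos]
      have : 0 < Real.log n := by linarith
      positivity
    · rw [Lewis.numIter]
      exact Nat.succ_le_of_lt (Nat.lt_ceil.2 (by push_cast; linarith))
  · obtain rfl : n = 1 := by omega
    simp
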